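/- For $n\ge 1$ let $\mathfrak S_n$ be the symmetric group on $\{1,\dots,n\}$, with permutations multiplied from left to right (the first factor is applied first), and let $\mathfrak M_n$ be the set of minimal factorizations of the $n$-cycle $(1,2,\dots,n)$, i.e. of tuples $(\tau_1,\dots,\tau_{n-1})$ of transpositions in $\mathfrak S_n$ with $\tau_1\tau_2\cdots\tau_{n-1}=(1,2,\dots,n)$, where $(1,2,\dots,n)$ maps $i$ to $i+1$ for $1\le i\le n-1$ and $n$ to $1$. For each $n\ge 3$ let $(t_1^{(n)},\dots,t_{n-1}^{(n)})$ be a uniform random element of $\mathfrak M_n$. Then the following hold. (i) For every $n\ge 3$, the random tuples $(t_1^{(n)},\dots,t_{n-2}^{(n)})$ and $(t_2^{(n)},\dots,t_{n-1}^{(n)})$ have the same distribution. (ii) For every $n\ge 3$, $1\le a\le n-1$ and $1\le i\le n-a$, $$\mathbb P\big(t_1^{(n)}=(a,a+i)\big)=\frac{(n-2)!}{n^{n-2}}\cdot\frac{i^{i-2}}{(i-1)!}\cdot\frac{(n-i)^{n-i-2}}{(n-i-1)!}.$$ In particular, writing $t_1^{(n)}=(a_n,b_n)$ with $a_n<b_n$,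 for every $i\ge 1$ $$\mathbb P(b_n-a_n=i)\;\longrightarrow\;\frac{i^{i-2}}{(i-1)!}\,e^{-i}\qquad(n\to\infty).$$ The numbers on the right-hand side are the masses of a probability distribution on $\{1,2,\dots\}$, the Borel distribution of parameter $1$ (equivalently, mass $e^{-i}i^{i-1}/i!$ at $i$), and $b_n-a_n$ converges in distribution to it. In addition, $a_n/n$ converges in distribution to a uniform random variable on $[0,1]$. -/

import Mathlib

open MeasureTheory ProbabilityTheory Filter Topology

namespace MinFact

/-- The finite symmetric group carries the discrete σ-algebra. -/
instance permMeasurableSpace (n : ℕ) : MeasurableSpace (Equiv.Perm (Fin n)) := ⊤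

/-- Minimal factorizations of the `n`-cycle `(1, 2, …, n)` into transpositions. The element
`k` of `{1, …, n}` is represented by `k - 1 : Fin n`, so the `n`-cycle is `finRotate n`.
Permutations are multiplied from left to right (the first factor is applied first), whereas
`*` on `Equiv.Perm` is composition; hence the reversal. -/
def minimalFactorizations (n : ℕ) : Set (Fin (n - 1) → Equiv.Perm (Fin n)) :=
  {τ | (∀ j, (τ j).IsSwap) ∧ (List.ofFn τ).reverse.prod = finRotate n}

/-- The transposition `(a, b)` of `{1, …, n}`, for `1 ≤ a < b ≤ n`. -/
def transposition (n a b : ℕ) (h : 1 ≤ a ∧ a < b ∧ b ≤ n) : Equiv.Perm (Fin n) :=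
  Equiv.swap ⟨a - 1, by omega⟩ ⟨b - 1, by omega⟩

/-- The Borel distribution of parameter `r`: it gives mass `e^{-r k} (r k)^{k-1} / k!` to each
integer `k ≥ 1`, and no mass to `0`. -/
noncomputable def borelDistribution (r : ℝ) : Measure ℕ :=
  Measure.sum fun k : ℕ =>
    (if k = 0 then 0
      else ENNReal.ofReal (Real.exp (-(r * k)) * (r * k) ^ (k - 1) / (k.factorial : ℝ))) •
      Measure.dirac k

end MinFact

/-!
The law of the first factor comes from a simple picture: multiplying the `n`-cycle by a
transposition `(a, a + i)` cuts it into an `i`-cycle and a disjoint `(n - i)`-cycle, up to relabelling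
(`exists_permCongr_sumCongr_finRotate`).

*Counting.* A product of two disjoint cycles covering `n` points, written with `n - 2`
transpositions, uses only transpositions inside the two cycles. Indeed `ℓ` transpositions always
preserve a colouring of the points with at least `n - ℓ` colours
(`exists_colouring_of_forall_isSwap`), so here there is an invariant colouring with two colours,
which must be the two cycles. Hence such a factorization is a shuffle of minimal factorizations of
the two cycles (`card_factorizations_sumCongr`), and the number of minimal factorizations starting
with `(a, a + i)` is `(n - 2).choose (i - 1) * F i * F (n - i)`, where `F n` is the number of
minimal factorizations of the `n`-cycle. Summing over all transpositions gives a recursion for `F`,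
which Abel's binomial identity (`sum_choose_mul_abel`) solves: `F n = n ^ (n - 2)` (`numMinimal_eq`). This
is the formula for the law of the first factor.

*Equality in distribution.* Conjugating the first factor by the cycle and moving it to the last
position is a bijection of the set of minimal factorizations, which turns the last `n - 2` factors
into the first `n - 2` ones (`identDistrib_castSucc_succ`).

*Limits.* Write `p n i` for the probability of `(a, a + i)`. By elementary asymptotics,
`n * p n i` converges to the Borel mass at `i` (`tendsto_mul_swapProb`). The Borel masses sum to `1`
(`hasSum_borelMass`): since `p n i = p n (n - i)`, for odd `n` the total probability
`∑ i, (n - i) * p n i` equals `∑ n * p n i` over `i < n / 2`, and on this range `n * p n i` is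
dominated by a multiple of the Borel mass. Since no mass is lost, the pointwise convergence of the
masses is convergence in distribution. Finally, if `k ≤ n - K` then the probability that `a = k` is
at least `∑ i ≤ K, p n i`, and `n` times this sum tends to a partial sum of the Borel masses, which
is arbitrarily close to `1`. Applied to the event `a / n ≤ x` and to its complement, this gives both
bounds on the limit of the distribution function (`tendsto_measureReal_fst_div_le`).
-/

/-! ### Factorizations in finite groups and products of transpositions -/

namespace MinFact

open Finset Equiv

section Counting

variable {G H : Type*} [Group G] [Fintype G] [DecidableEq G] [Group H] [Fintype H] [DecidableEq H]

/-- The factorizations of `g` into `ℓ` factors taken from `S`, multiplied from left to right in the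
sense of `minimalFactorizations`. -/
def factorizations (S : Finset G) (ℓ : ℕ) (g : G) : Finset (Fin ℓ → G) :=
  {τ | (∀ j, τ j ∈ S) ∧ (List.ofFn τ).reverse.prod = g}

lemma mem_factorizations {S : Finset G} {ℓ : ℕ} {g : G} {τ : Fin ℓ → G} :
    τ ∈ factorizations S ℓ g ↔ (∀ j, τ j ∈ S) ∧ (List.ofFn τ).reverse.prod = g := by
  simp [factorizations]

lemma card_factorizations_zero (S : Finset G) (g : G) :
    #(factorizations S 0 g) = if g = 1 then 1 else 0 := by
  split_ifs with h
  · rw [card_eq_one]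
    refine ⟨Fin.elim0, ?_⟩
    ext τ
    simp [mem_factorizations, h, Subsingleton.elim τ Fin.elim0]
  · rw [card_eq_zero]
    ext τ
    simp [mem_factorizations, Ne.symm h]

lemma card_filter_factorizations_succ (S : Finset G) (ℓ : ℕ) (g : G) {s : G} (hs : s ∈ S) :
    #{τ ∈ factorizations S (ℓ + 1) g | τ 0 = s} = #(factorizations S ℓ (g * s⁻¹)) := by
  symm
  refine card_bij (fun τ _ => Fin.cons s τ) ?_ ?_ ?_
  · intro τ hτ
    rw [mem_factorizations] at hτ
    simp only [mem_filter, mem_factorizations, Fin.cons_zero, and_true]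
    refine ⟨fun j => ?_, by simp [List.ofFn_succ, hτ.2]⟩
    refine Fin.cases ?_ (fun j => ?_) j
    · simpa using hs
    · simpa using hτ.1 j
  · intro τ _ τ' _ h
    exact Fin.cons_right_injective (α := fun _ => G) s h
  · intro τ hτ
    simp only [mem_filter, mem_factorizations] at hτ
    obtain ⟨⟨h1, h2⟩, rfl⟩ := hτ
    refine ⟨Fin.tail τ, ?_, Fin.cons_self_tail τ⟩
    rw [mem_factorizations]
    refine ⟨fun j => h1 _, ?_⟩
    rw [eq_mul_inv_iff_mul_eq, ← h2]
    simp [List.ofFn_succ, Fin.tail_def]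

lemma card_factorizations_succ (S : Finset G) (ℓ : ℕ) (g : G) :
    #(factorizations S (ℓ + 1) g) = ∑ s ∈ S, #(factorizations S ℓ (g * s⁻¹)) := by
  rw [card_eq_sum_card_fiberwise (f := fun τ => τ 0) (t := S)]
  · exact sum_congr rfl fun s hs => card_filter_factorizations_succ S ℓ g hs
  · intro τ hτ
    exact (mem_factorizations.1 hτ).1 0

lemma card_factorizations_image (φ : G →* H) (hφ : Function.Injective φ) (S : Finset G) (ℓ : ℕ)
    (g : G) : #(factorizations (S.image φ) ℓ (φ g)) = #(factorizations S ℓ g) := by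
  induction ℓ generalizing g with
  | zero => simp [card_factorizations_zero, map_eq_one_iff φ hφ]
  | succ ℓ ih =>
    rw [card_factorizations_succ, card_factorizations_succ, sum_image hφ.injOn]
    refine sum_congr rfl fun s _ => ?_
    rw [← ih, map_mul, map_inv]

lemma factorizations_eq_of_subset {S T : Finset G} {ℓ : ℕ} {g : G} (hTS : T ⊆ S)
    (h : ∀ τ ∈ factorizations S ℓ g, ∀ j, τ j ∈ T) :
    factorizations S ℓ g = factorizations T ℓ g := by
  ext τ
  refine ⟨fun hτ => mem_factorizations.2 ⟨h τ hτ, (mem_factorizations.1 hτ).2⟩, fun hτ => ?_⟩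
  rw [mem_factorizations] at hτ ⊢
  exact ⟨fun j => hTS (hτ.1 j), hτ.2⟩

/-- A factorization of `(g, h)` into elements of the two factors of a product group is a shuffle of
a factorization of `g` and a factorization of `h`. -/
lemma card_factorizations_prod {S : Finset G} {T : Finset H} (hS : 1 ∉ S) (ℓ : ℕ) (g : G) (h : H) :
    #(factorizations (S.image (MonoidHom.inl G H) ∪ T.image (MonoidHom.inr G H)) ℓ (g, h)) =
      ∑ p ∈ antidiagonal ℓ,
        ℓ.choose p.1 * (#(factorizations S p.1 g) * #(factorizations T p.2 h)) := by
  induction ℓ generalizing g h with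
  | zero => simp [card_factorizations_zero, ← ite_and, and_comm]
  | succ ℓ ih =>
    have hdisj : Disjoint (S.image (MonoidHom.inl G H)) (T.image (MonoidHom.inr G H)) := by
      rw [disjoint_left]
      simp only [mem_image, MonoidHom.inl_apply, MonoidHom.inr_apply, not_exists, not_and]
      rintro _ ⟨s, hs, rfl⟩ t ht hst
      rw [Prod.mk.injEq] at hst
      exact hS (hst.1 ▸ hs)
    have hpascal := Finset.sum_antidiagonal_choose_succ_mul (R := ℕ)
      (fun p q => #(factorizations S p g) * #(factorizations T q h)) ℓ
    simp only [Nat.cast_id] at hpascal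
    rw [hpascal, card_factorizations_succ, sum_union hdisj,
      sum_image (by intro x _ y _; simp), sum_image (by intro x _ y _; simp), add_comm]
    congr 1
    · simp only [MonoidHom.inr_apply, Prod.inv_mk, Prod.mk_mul_mk, inv_one, mul_one, ih,
        card_factorizations_succ T]
      rw [sum_comm]
      simp only [mul_sum]
    · simp only [MonoidHom.inl_apply, Prod.inv_mk, Prod.mk_mul_mk, inv_one, mul_one, ih,
        card_factorizations_succ S]
      rw [sum_comm]
      refine sum_congr rfl fun p hp => ?_
      rw [← HasAntidiagonal.mem_antidiagonal.1 hp, Nat.choose_symm_add, sum_mul, mul_sum]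

end Counting

section Transpositions

variable {α β : Type*}

open Classical in
/-- The transpositions of a finite type. -/
noncomputable def swaps (α : Type*) [Fintype α] [DecidableEq α] : Finset (Perm α) := {τ | τ.IsSwap}

@[simp]
lemma mem_swaps [Fintype α] [DecidableEq α] {τ : Perm α} : τ ∈ swaps α ↔ τ.IsSwap := by simp [swaps]

lemma one_notMem_swaps [Fintype α] [DecidableEq α] : (1 : Perm α) ∉ swaps α := by
  rw [mem_swaps]
  rintro ⟨x, y, hxy, h⟩
  exact hxy (swap_eq_one_iff.1 h.symm)

/-- A colouring lemma: `ℓ` transpositions preserve some colouring with at least `#α - ℓ` colours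
(colour a point by its connected component in the graph spanned by the transpositions). -/
lemma exists_colouring_of_forall_isSwap [Fintype α] [DecidableEq α] (l : List (Perm α))
    (hl : ∀ τ ∈ l, τ.IsSwap) :
    ∃ f : α → α, (∀ τ ∈ l, ∀ x, f (τ x) = f x) ∧
      Fintype.card α ≤ #(univ.image f) + l.length := by
  induction l with
  | nil => exact ⟨id, by simp, by simp⟩
  | cons τ l ih =>
    obtain ⟨f, hf, hcard⟩ := ih fun σ hσ => hl σ (List.mem_cons_of_mem _ hσ)
    obtain ⟨x, y, -, rfl⟩ := hl τ List.mem_cons_self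
    -- merge the colours of `x` and `y`
    set u : α → α := fun z => if z = f x then f y else z with hu
    refine ⟨u ∘ f, ?_, ?_⟩
    · simp only [List.mem_cons, forall_eq_or_imp]
      refine ⟨fun z => ?_, fun σ hσ z => by simp [hf σ hσ z]⟩
      rcases eq_or_ne z x with rfl | hx
      · simp [hu]
      · rcases eq_or_ne z y with rfl | hy
        · simp [hu]
        · rw [swap_apply_of_ne_of_ne hx hy]
    · have : univ.image f ⊆ insert (f x) (univ.image (u ∘ f)) := by
        intro z hz
        obtain ⟨w, -, rfl⟩ := mem_image.1 hz
        by_cases hw : f w = f x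
        · simp [hw]
        · refine mem_insert_of_mem (mem_image.2 ⟨w, mem_univ _, ?_⟩)
          simp [hu, hw]
      have h1 := (card_le_card this).trans (card_insert_le _ _)
      simp only [List.length_cons]
      omega

lemma apply_list_prod_of_forall (f : α → β) (l : List (Perm α))
    (hf : ∀ τ ∈ l, ∀ x, f (τ x) = f x) (x : α) : f (l.prod x) = f x := by
  induction l generalizing x with
  | nil => simp
  | cons τ l ih =>
    rw [List.prod_cons, Perm.mul_apply, hf τ List.mem_cons_self,
      ih fun σ hσ => hf σ (List.mem_cons_of_mem _ hσ)]

/-- A function invariant under a cyclic rotation is constant. -/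
lemma eq_of_forall_finRotate {n : ℕ} {f : Fin n → β} (hf : ∀ x, f (finRotate n x) = f x)
    (x y : Fin n) : f x = f y := by
  cases n with
  | zero => exact x.elim0
  | succ n =>
    suffices h : ∀ x, f x = f 0 by rw [h x, h y]
    intro x
    induction x using Fin.induction with
    | zero => rfl
    | succ i ih => rw [← ih, ← hf i.castSucc, finRotate_apply, Fin.coeSucc_eq_succ]

lemma exists_colouring_of_mem_factorizations [Fintype α] [DecidableEq α] {ℓ : ℕ}
    {σ : Perm α} {τ : Fin ℓ → Perm α} (hτ : τ ∈ factorizations (swaps α) ℓ σ) :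
    ∃ f : α → α, (∀ j x, f (τ j x) = f x) ∧ (∀ x, f (σ x) = f x) ∧
      Fintype.card α ≤ #(univ.image f) + ℓ := by
  rw [mem_factorizations] at hτ
  obtain ⟨f, hf, hcard⟩ := exists_colouring_of_forall_isSwap (List.ofFn τ).reverse (by
    simpa [List.mem_ofFn] using hτ.1)
  refine ⟨f, fun j => hf _ (by simp [List.mem_ofFn]), fun x => ?_, by simpa using hcard⟩
  rw [← hτ.2]
  exact apply_list_prod_of_forall f _ hf x

/-- An `n`-cycle is not a product of fewer than `n - 1` transpositions. -/
lemma factorizations_finRotate_eq_empty {n ℓ : ℕ} (h : ℓ + 1 < n) :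
    factorizations (swaps (Fin n)) ℓ (finRotate n) = ∅ := by
  rw [eq_empty_iff_forall_notMem]
  intro τ hτ
  obtain ⟨f, -, hf, hcard⟩ := exists_colouring_of_mem_factorizations hτ
  have : #(univ.image f) ≤ 1 := by
    rw [card_le_one]
    simp only [mem_image, mem_univ, true_and, forall_exists_index, forall_apply_eq_imp_iff]
    exact fun x y => eq_of_forall_finRotate hf x y
  rw [Fintype.card_fin] at hcard
  omega

lemma isSwap_sumCongr_left [DecidableEq α] [DecidableEq β] {τ : Perm α} (hτ : τ.IsSwap) :
    (Perm.sumCongrHom α β (τ, 1)).IsSwap := by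
  obtain ⟨x, y, hxy, rfl⟩ := hτ
  exact ⟨Sum.inl x, Sum.inl y, by simpa using hxy, by simp⟩

lemma isSwap_sumCongr_right [DecidableEq α] [DecidableEq β] {τ : Perm β} (hτ : τ.IsSwap) :
    (Perm.sumCongrHom α β (1, τ)).IsSwap := by
  obtain ⟨x, y, hxy, rfl⟩ := hτ
  exact ⟨Sum.inr x, Sum.inr y, by simpa using hxy, by simp⟩

/-- In a factorization of a product of two disjoint cycles covering `i + m` points into `i + m - 2`
transpositions, every transposition lies inside one of the two cycles: otherwise the only
invariant colourings would be the constant ones. -/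
lemma mem_of_mem_factorizations_sumCongr {i m ℓ : ℕ} (hℓ : ℓ + 2 ≤ i + m)
    {τ : Fin ℓ → Perm (Fin i ⊕ Fin m)}
    (hτ : τ ∈ factorizations (swaps (Fin i ⊕ Fin m)) ℓ
      (Perm.sumCongr (finRotate i) (finRotate m))) (j : Fin ℓ) :
    τ j ∈ ((swaps (Fin i)).image (MonoidHom.inl _ _) ∪
      (swaps (Fin m)).image (MonoidHom.inr _ _)).image (Perm.sumCongrHom (Fin i) (Fin m)) := by
  obtain ⟨f, hf, hfσ, hcard⟩ := exists_colouring_of_mem_factorizations hτ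
  have hl : ∀ x y, f (Sum.inl x) = f (Sum.inl y) := fun x y =>
    eq_of_forall_finRotate (f := fun x => f (Sum.inl x)) (fun x => hfσ (Sum.inl x)) x y
  have hr : ∀ x y, f (Sum.inr x) = f (Sum.inr y) := fun x y =>
    eq_of_forall_finRotate (f := fun x => f (Sum.inr x)) (fun x => hfσ (Sum.inr x)) x y
  have hlr : ∀ x y, f (Sum.inl x) ≠ f (Sum.inr y) := by
    intro x y hxy
    have : #(univ.image f) ≤ 1 := by
      rw [card_le_one]
      simp only [mem_image, mem_univ, true_and, forall_exists_index, forall_apply_eq_imp_iff]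
      rintro (u | u) (v | v)
      · exact hl u v
      · rw [hl u x, hxy, hr y v]
      · rw [hr u y, ← hxy, hl x v]
      · exact hr u v
    rw [Fintype.card_sum, Fintype.card_fin, Fintype.card_fin] at hcard
    omega
  obtain ⟨u, v, huv, hj⟩ := mem_swaps.1 ((mem_factorizations.1 hτ).1 j)
  have hfuv : f v = f u := by simpa [hj] using hf j u
  rw [hj]
  simp only [mem_image, mem_union]
  rcases u with u | u <;> rcases v with v | v
  · exact ⟨_, Or.inl ⟨swap u v, mem_swaps.2 ⟨u, v, by simpa using huv, rfl⟩, rfl⟩, by simp⟩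
  · exact absurd hfuv.symm (hlr u v)
  · exact absurd hfuv (hlr v u)
  · exact ⟨_, Or.inr ⟨swap u v, mem_swaps.2 ⟨u, v, by simpa using huv, rfl⟩, rfl⟩, by simp⟩

lemma swaps_image_permCongrHom [Fintype α] [DecidableEq α] [Fintype β] [DecidableEq β] (e : α ≃ β) :
    (swaps α).image e.permCongrHom = swaps β := by
  ext τ
  simp only [mem_image, mem_swaps]
  constructor
  · rintro ⟨σ, ⟨x, y, hxy, rfl⟩, rfl⟩
    exact ⟨e x, e y, by simpa using hxy, by
      ext z; simp [swap_apply_def, apply_ite e, symm_apply_eq]⟩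
  · rintro ⟨x, y, hxy, rfl⟩
    exact ⟨swap (e.symm x) (e.symm y), ⟨_, _, by simpa using hxy, rfl⟩, by
      ext z; simp [swap_apply_def, apply_ite e]⟩

lemma card_factorizations_permCongr [Fintype α] [DecidableEq α] [Fintype β] [DecidableEq β]
    (e : α ≃ β) (ℓ : ℕ) (σ : Perm α) :
    #(factorizations (swaps β) ℓ (e.permCongr σ)) = #(factorizations (swaps α) ℓ σ) := by
  rw [← swaps_image_permCongrHom e]
  exact card_factorizations_image e.permCongrHom.toMonoidHom e.permCongrHom.injective _ ℓ σ

end Transpositions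

/-- The number of minimal factorizations of the `n`-cycle. -/
noncomputable def numMinimal (n : ℕ) : ℕ := #(factorizations (swaps (Fin n)) (n - 1) (finRotate n))

lemma card_factorizations_sumCongr {i m : ℕ} (hi : 1 ≤ i) (hm : 1 ≤ m) :
    #(factorizations (swaps (Fin i ⊕ Fin m)) (i + m - 2)
      (Perm.sumCongr (finRotate i) (finRotate m))) =
      (i + m - 2).choose (i - 1) * (numMinimal i * numMinimal m) := by
  rw [factorizations_eq_of_subset (T := ((swaps (Fin i)).image (MonoidHom.inl _ _) ∪
      (swaps (Fin m)).image (MonoidHom.inr _ _)).image (Perm.sumCongrHom (Fin i) (Fin m))) ?_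
      fun τ hτ j => mem_of_mem_factorizations_sumCongr (by omega) hτ j]
  · have := card_factorizations_image (Perm.sumCongrHom (Fin i) (Fin m))
      Perm.sumCongrHom_injective ((swaps (Fin i)).image (MonoidHom.inl _ _) ∪
      (swaps (Fin m)).image (MonoidHom.inr _ _)) (i + m - 2) (finRotate i, finRotate m)
    rw [Perm.sumCongrHom_apply] at this
    rw [this, card_factorizations_prod one_notMem_swaps]
    rw [sum_eq_single (i - 1, m - 1)]
    · rfl
    · rintro ⟨p, q⟩ hpq hne
      rw [HasAntidiagonal.mem_antidiagonal] at hpq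
      simp only at hpq
      have : p + 1 < i ∨ q + 1 < m := by
        by_contra! h
        exact hne (Prod.ext (by simp only; omega) (by simp only; omega))
      rcases this with h | h <;> simp [factorizations_finRotate_eq_empty h]
    · intro h
      exact absurd (HasAntidiagonal.mem_antidiagonal.2 (by simp only; omega)) h
  · intro τ hτ
    simp only [mem_image, mem_union, mem_swaps] at hτ
    rw [mem_swaps]
    rcases hτ with ⟨_, ⟨τ, hτ, rfl⟩ | ⟨τ, hτ, rfl⟩, rfl⟩
    · exact isSwap_sumCongr_left hτ
    · exact isSwap_sumCongr_right hτ

end MinFact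

/-! ### Cutting a cycle, Abel's identity and Dénes' formula -/

namespace MinFact

open Finset Equiv

/-- Splitting off a transposition cuts a cycle into two cycles. -/
lemma permCongr_finSumFinEquiv_sumCongr_finRotate {i m : ℕ} (hi : 1 ≤ i) (hm : 1 ≤ m) :
    finSumFinEquiv.permCongr (Perm.sumCongr (finRotate i) (finRotate m)) =
      finRotate (i + m) * swap ⟨i + m - 1, by omega⟩ ⟨i - 1, by omega⟩ := by
  obtain ⟨i, rfl⟩ : ∃ i', i = i' + 1 := ⟨i - 1, by omega⟩
  obtain ⟨m, rfl⟩ : ∃ m', m = m' + 1 := ⟨m - 1, by omega⟩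
  have hswap : ∀ z w : Fin (i + 1 + (m + 1)), swap (⟨i + 1 + (m + 1) - 1, by omega⟩ :
      Fin (i + 1 + (m + 1))) ⟨i + 1 - 1, by omega⟩ z = w →
      ((z : ℕ) = i + 1 + m ∧ (w : ℕ) = i) ∨ ((z : ℕ) = i ∧ (w : ℕ) = i + 1 + m) ∨
        ((z : ℕ) ≠ i + 1 + m ∧ (z : ℕ) ≠ i ∧ (w : ℕ) = z) := by
    rintro z w rfl
    rw [swap_apply_def]
    split_ifs with h1 h2
    · exact Or.inl ⟨congrArg Fin.val h1, rfl⟩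
    · exact Or.inr (Or.inl ⟨congrArg Fin.val h2, rfl⟩)
    · exact Or.inr (Or.inr ⟨fun h => h1 (Fin.ext h), fun h => h2 (Fin.ext h), rfl⟩)
  have hrot : ∀ (k : ℕ) (z : Fin (k + 1)), ((z : ℕ) = k ∧ (finRotate (k + 1) z : ℕ) = 0) ∨
      ((z : ℕ) ≠ k ∧ (finRotate (k + 1) z : ℕ) = z + 1) := fun k z => by
    rw [coe_finRotate]
    split_ifs with h
    · exact Or.inl ⟨congrArg Fin.val h, rfl⟩
    · exact Or.inr ⟨fun h' => h (Fin.ext h'), rfl⟩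
  ext x
  obtain ⟨x, rfl⟩ := finSumFinEquiv.surjective x
  rw [permCongr_apply, symm_apply_apply, Perm.mul_apply, Perm.sumCongr_apply]
  generalize hw : swap (⟨i + 1 + (m + 1) - 1, by omega⟩ : Fin (i + 1 + (m + 1)))
    ⟨i + 1 - 1, by omega⟩ (finSumFinEquiv x) = w
  have h1 := hswap _ _ hw
  have h2 := hrot (i + 1 + m) w
  change _ = (finRotate (i + 1 + m + 1) w : ℕ)
  rcases x with x | x
  · have := x.2
    have h3 := hrot _ x
    simp only [Sum.map_inl, finSumFinEquiv_apply_left, Fin.val_castAdd] at h1 ⊢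
    omega
  · have := x.2
    have h3 := hrot _ x
    simp only [Sum.map_inr, finSumFinEquiv_apply_right, Fin.val_natAdd] at h1 ⊢
    omega

/-- Removing a transposition `(a, a + i)` from an `n`-cycle leaves two disjoint cycles, of lengths
`i` and `n - i`. -/
lemma exists_permCongr_sumCongr_finRotate {n i m : ℕ} (hi : 1 ≤ i) (hm : 1 ≤ m) (hn : i + m = n)
    {a b : Fin n} (hab : (a : ℕ) + i = b) :
    ∃ e : Fin i ⊕ Fin m ≃ Fin n,
      e.permCongr (Perm.sumCongr (finRotate i) (finRotate m)) = finRotate n * swap a b := by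
  subst hn
  have : NeZero (i + m) := ⟨by omega⟩
  have ha := a.2
  have hb := b.2
  -- rotate so that the larger entry of the transposition becomes the last point
  refine ⟨finSumFinEquiv.trans (Equiv.addRight (a + 1)), ?_⟩
  have hone : 1 % (i + m) = 1 := Nat.mod_eq_of_lt (by omega)
  have h1 : (⟨i + m - 1, by omega⟩ : Fin (i + m)) + (a + 1) = a := by
    ext
    simp only [Fin.val_add, Fin.val_one', hone, Nat.add_mod_mod]
    rw [show i + m - 1 + (a + 1) = a + (i + m) by omega, Nat.add_mod_right, Nat.mod_eq_of_lt ha]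
  have h2 : (⟨i - 1, by omega⟩ : Fin (i + m)) + (a + 1) = b := by
    ext
    simp only [Fin.val_add, Fin.val_one', hone, Nat.add_mod_mod]
    rw [show i - 1 + ((a : ℕ) + 1) = b by omega, Nat.mod_eq_of_lt hb]
  have hcomp : (finSumFinEquiv.trans (Equiv.addRight (a + 1))).permCongr
      (Perm.sumCongr (finRotate i) (finRotate m)) = (Equiv.addRight (a + 1)).permCongr
        (finSumFinEquiv.permCongr (Perm.sumCongr (finRotate i) (finRotate m))) := rfl
  rw [hcomp, permCongr_finSumFinEquiv_sumCongr_finRotate hi hm]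
  refine Equiv.ext fun x => ?_
  obtain ⟨y, rfl⟩ := (Equiv.addRight (a + 1)).surjective x
  have hsw := (Equiv.addRight (a + 1)).injective.swap_apply (⟨i + m - 1, by omega⟩ : Fin (i + m))
    ⟨i - 1, by omega⟩ y
  rw [permCongr_apply, symm_apply_apply, Perm.mul_apply, Perm.mul_apply]
  simp only [coe_addRight, finRotate_apply] at hsw ⊢
  rw [h1, h2] at hsw
  rw [hsw]
  abel

lemma card_factorizations_finRotate_mul_swap {n i : ℕ} (hi : 1 ≤ i) {a b : Fin n}
    (hab : (a : ℕ) + i = b) :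
    #(factorizations (swaps (Fin n)) (n - 2) (finRotate n * swap a b)) =
      (n - 2).choose (i - 1) * (numMinimal i * numMinimal (n - i)) := by
  have hb := b.2
  obtain ⟨e, he⟩ := exists_permCongr_sumCongr_finRotate (m := n - i) hi (by omega) (by omega) hab
  rw [← he, card_factorizations_permCongr]
  have := card_factorizations_sumCongr (m := n - i) hi (by omega)
  rwa [show i + (n - i) = n by omega] at this

lemma eq_and_eq_of_swap_eq_swap {n : ℕ} {a b a' b' : Fin n} (h : a < b) (h' : a' < b')
    (heq : swap a b = swap a' b') : a = a' ∧ b = b' := by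
  have h1 : b = swap a' b' a := by simp [← heq]
  rw [swap_apply_def] at h1
  split_ifs at h1 with h2 h3
  · exact ⟨h2, h1⟩
  · exact absurd h (by rw [h1, h3]; exact lt_asymm h')
  · exact absurd h1.symm h.ne

/-- Transpositions are parametrized by their ordered entries. -/
lemma sum_swaps {M : Type*} [AddCommMonoid M] (n : ℕ) (f : Perm (Fin n) → M) :
    ∑ s ∈ swaps (Fin n), f s = ∑ b, ∑ a ∈ Iio b, f (swap a b) := by
  rw [sum_sigma']
  refine (sum_bij (fun p _ => swap p.2 p.1) ?_ ?_ ?_ ?_).symm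
  · rintro ⟨b, a⟩ h
    simp only [mem_sigma, mem_univ, mem_Iio, true_and] at h
    exact mem_swaps.2 ⟨a, b, h.ne, rfl⟩
  · rintro ⟨b, a⟩ h ⟨b', a'⟩ h' heq
    simp only [mem_sigma, mem_univ, mem_Iio, true_and] at h h'
    obtain ⟨rfl, rfl⟩ := eq_and_eq_of_swap_eq_swap h h' heq
    rfl
  · intro s hs
    obtain ⟨x, y, hxy, rfl⟩ := mem_swaps.1 hs
    rcases hxy.lt_or_gt with h | h
    · exact ⟨⟨y, x⟩, by simpa using h, rfl⟩
    · exact ⟨⟨x, y⟩, by simpa using h, swap_comm _ _⟩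
  · simp

lemma sum_fin_sum_Iio_sub {M : Type*} [AddCommMonoid M] (n : ℕ) (g : ℕ → M) :
    ∑ b : Fin n, ∑ a ∈ Iio b, g (b - a) = ∑ i ∈ Icc 1 (n - 1), (n - i) • g i := by
  have h1 (b : Fin n) : ∑ a ∈ Iio b, g (b - a) = ∑ i ∈ Icc 1 (b : ℕ), g i := by
    refine sum_bij' (fun a _ => (b : ℕ) - a) (fun i _ => ⟨b - i, by omega⟩) ?_ ?_ ?_ ?_ ?_
    · intro a ha
      rw [mem_Iio, Fin.lt_def] at ha
      simp only [mem_Icc]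
      omega
    · intro i hi
      rw [mem_Icc] at hi
      simp only [mem_Iio, Fin.lt_def]
      omega
    · intro a ha
      rw [mem_Iio, Fin.lt_def] at ha
      ext
      simp only
      omega
    · intro i hi
      rw [mem_Icc] at hi
      simp only
      omega
    · simp
  simp only [h1]
  rw [Fin.sum_univ_eq_sum_range (fun b => ∑ i ∈ Icc 1 b, g i) n,
    sum_comm' (t' := Icc 1 (n - 1)) (s' := fun i => Ico i n)]
  · simp
  · intro b i
    simp only [mem_range, mem_Icc, mem_Ico]
    omega

/-- Dénes' recursion, obtained by removing the first transposition `(a, a + i)`. -/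
lemma numMinimal_eq_sum {n : ℕ} (hn : 2 ≤ n) :
    numMinimal n = ∑ i ∈ Icc 1 (n - 1),
      (n - i) * ((n - 2).choose (i - 1) * (numMinimal i * numMinimal (n - i))) := by
  have h := sum_fin_sum_Iio_sub n
    (fun i => (n - 2).choose (i - 1) * (numMinimal i * numMinimal (n - i)))
  simp only [smul_eq_mul] at h
  rw [← h, numMinimal, show n - 1 = n - 2 + 1 by omega, card_factorizations_succ, sum_swaps]
  refine sum_congr rfl fun b _ => sum_congr rfl fun a ha => ?_
  rw [mem_Iio, Fin.lt_def] at ha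
  rw [swap_inv, card_factorizations_finRotate_mul_swap (i := b - a) (by omega) (by omega)]

/-- **Abel's binomial identity**, in the case where the first variable equals `1`. -/
lemma sum_choose_mul_abel (n : ℕ) : ∀ y : ℝ, ∑ k ∈ range (n + 1),
    (n.choose k : ℝ) * (1 + k) ^ ((k : ℤ) - 1) * (y + (n - k : ℕ)) ^ (n - k) =
      (1 + y + n) ^ n := by
  induction n with
  | zero => simp
  | succ n ih =>
    set L : ℝ → ℝ := fun y => ∑ k ∈ range (n + 2),
      ((n + 1).choose k : ℝ) * (1 + k) ^ ((k : ℤ) - 1) * (y + (n + 1 - k : ℕ)) ^ (n + 1 - k) with hL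
    have hd : ∀ y, HasDerivAt L ((n + 1) * (1 + (y + 1) + n) ^ n) y := by
      intro y
      have h1 : HasDerivAt L (∑ k ∈ range (n + 2),
          ((n + 1).choose k : ℝ) * (1 + k) ^ ((k : ℤ) - 1) *
            ((n + 1 - k : ℕ) * (y + (n + 1 - k : ℕ)) ^ (n + 1 - k - 1) * 1)) y := by
        refine HasDerivAt.fun_sum fun k _ => HasDerivAt.const_mul _ ?_
        exact ((hasDerivAt_id y).add_const _).pow _
      convert h1 using 1
      rw [sum_range_succ, ← ih (y + 1), mul_sum]
      simp only [Nat.sub_self, Nat.cast_zero, zero_mul, mul_zero, add_zero]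
      refine sum_congr rfl fun k hk => ?_
      rw [mem_range] at hk
      have h2 : ((n + 1).choose k : ℝ) * (n + 1 - k : ℕ) = (n + 1) * n.choose k := by
        have := Nat.choose_mul_succ_eq n k
        rw [mul_comm] at this
        exact_mod_cast this.symm
      have h3 : n + 1 - k - 1 = n - k := by omega
      have h4 : n + 1 - k = n - k + 1 := by omega
      rw [h3, show y + ((n + 1 - k : ℕ) : ℝ) = y + 1 + (n - k : ℕ) by rw [h4]; push_cast; ring]
      linear_combination (-(1 + (k : ℝ)) ^ ((k : ℤ) - 1) * (y + 1 + (n - k : ℕ)) ^ (n - k)) * h2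
    have hd' : ∀ y : ℝ, HasDerivAt (fun y : ℝ => (1 + y + (n + 1 : ℕ)) ^ (n + 1))
        ((n + 1) * (1 + (y + 1) + n) ^ n) y := by
      intro y
      have := (((hasDerivAt_id y).const_add 1).add_const ((n + 1 : ℕ) : ℝ)).pow (n + 1)
      refine this.congr_deriv ?_
      rw [Nat.add_sub_cancel, id_eq]
      push_cast
      ring
    -- both sides have the same derivative, and agree at `y = -n - 2` since a finite difference of
    -- order `n + 1` kills polynomials of degree `n`
    have h0 : L (-(n + 2)) = 0 := by
      have hf := congrFun (fwdDiff_iter_pow_eq_zero_of_lt (R := ℝ) (Nat.lt_succ_self n)) 1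
      rw [fwdDiff_iter_eq_sum_shift] at hf
      rw [hL]
      refine Eq.trans ?_ hf
      refine sum_congr rfl fun k hk => ?_
      rw [mem_range] at hk
      have h5 : (-((n : ℝ) + 2) + (n + 1 - k : ℕ)) = -(1 + k) := by
        rw [Nat.cast_sub (by omega)]; push_cast; ring
      have h6 : (1 + (k : ℝ)) ^ ((k : ℤ) - 1) * (1 + k) ^ (n + 1 - k) = (1 + k) ^ n := by
        rw [← zpow_natCast, ← zpow_natCast, ← zpow_add₀ (by positivity)]
        congr 1
        omega
      rw [h5, neg_pow]
      simp only [nsmul_eq_mul, mul_one, zsmul_eq_mul]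
      push_cast
      rw [← h6]
      ring
    intro y
    have hconst : ∀ z, L z - (1 + z + (n + 1 : ℕ)) ^ (n + 1) = 0 := by
      have hderiv : ∀ z, HasDerivAt (fun y => L y - (1 + y + (n + 1 : ℕ)) ^ (n + 1)) 0 z := by
        intro z
        exact ((hd z).sub (hd' z)).congr_deriv (sub_self _)
      intro z
      rw [is_const_of_deriv_eq_zero (fun z => (hderiv z).differentiableAt)
        (fun z => (hderiv z).deriv) z (-(n + 2)), h0]
      push_cast
      rw [show (1 + -((n : ℝ) + 2) + (n + 1)) = 0 by ring]
      simp
    have := hconst y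
    rw [sub_eq_zero] at this
    exact this

/-- **Dénes' formula**: the `n`-cycle has `n ^ (n - 2)` minimal factorizations. -/
theorem numMinimal_eq {n : ℕ} (hn : 1 ≤ n) : numMinimal n = n ^ (n - 2) := by
  induction n using Nat.strong_induction_on with
  | _ n ih =>
  rcases hn.eq_or_lt with rfl | hn
  · simp [numMinimal, card_factorizations_zero, finRotate_one, Perm.one_def]
  · rw [numMinimal_eq_sum hn]
    obtain ⟨m, rfl⟩ : ∃ m, n = m + 2 := ⟨n - 2, by omega⟩
    have habel := sum_choose_mul_abel m 1
    rw [Nat.add_sub_cancel, show m + 2 - 1 = m + 1 by omega]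
    have : Icc 1 (m + 1) = (range (m + 1)).image (· + 1) := by
      ext i
      simp only [mem_Icc, mem_image, mem_range]
      exact ⟨fun h => ⟨i - 1, by omega, by omega⟩, by rintro ⟨j, hj, rfl⟩; omega⟩
    rw [this, sum_image (by simp)]
    rw [← Nat.cast_inj (R := ℝ)]
    push_cast
    rw [show ((m : ℝ) + 2) = 1 + 1 + m by ring, ← habel]
    refine sum_congr rfl fun k hk => ?_
    rw [mem_range] at hk
    rw [show m + 1 - k = m - k + 1 by omega, ih (k + 1) (by omega) (by omega),
      ih (m - k + 1) (by omega) (by omega)]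
    have h2 : (((k + 1) ^ (k + 1 - 2) : ℕ) : ℝ) = (1 + k) ^ ((k : ℤ) - 1) := by
      rcases k with _ | k
      · simp
      · rw [show k + 1 + 1 - 2 = k by omega]
        push_cast
        rw [add_sub_cancel_right, zpow_natCast]
        ring
    have h3 : (((m - k + 1 : ℕ) : ℝ)) * ((m - k + 1) ^ (m - k + 1 - 2) : ℕ) =
        (1 + (m - k : ℕ)) ^ (m - k) := by
      rcases m - k with _ | j
      · simp
      · rw [show j + 1 + 1 - 2 = j by omega]
        push_cast
        ring
    rw [h2, ← h3]
    ring

end MinFact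

/-! ### The law of the first factor and its local limit -/

namespace MinFact

open Finset

/-- The probability that the first factor of a uniform minimal factorization of the `n`-cycle is a
given transposition `(a, a + i)`. -/
noncomputable def swapProb (n i : ℕ) : ℝ :=
  ((n - 2).factorial : ℝ) / (n : ℝ) ^ (n - 2) *
    ((i : ℝ) ^ ((i : ℤ) - 2) / ((i - 1).factorial : ℝ)) *
    (((n : ℝ) - i) ^ ((n : ℤ) - i - 2) / ((n - i - 1).factorial : ℝ))

/-- The mass `i ^ (i - 2) e ^ (-i) / (i - 1)!` of the Borel distribution of parameter `1` at `i`;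
the formula gives the correct value `0` at `i = 0`, where `i ^ (i - 2) = 0 ^ (-2) = 0`. -/
noncomputable def borelMass (i : ℕ) : ℝ :=
  (i : ℝ) ^ ((i : ℤ) - 2) / ((i - 1).factorial : ℝ) * Real.exp (-(i : ℝ))

@[simp]
lemma borelMass_zero : borelMass 0 = 0 := by
  simp [borelMass]

lemma borelMass_nonneg (i : ℕ) : 0 ≤ borelMass i := by
  unfold borelMass
  positivity

lemma swapProb_nonneg {n i : ℕ} (h : i ≤ n) : 0 ≤ swapProb n i := by
  have : (0 : ℝ) ≤ (n : ℝ) - i := sub_nonneg.2 (Nat.cast_le.2 h)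
  unfold swapProb
  positivity

lemma natCast_pow_sub_two {n : ℕ} (hn : 1 ≤ n) : (n : ℝ) ^ ((n : ℤ) - 2) = (n : ℝ) ^ (n - 2) := by
  rcases hn.eq_or_lt with rfl | hn
  · simp
  · rw [← zpow_natCast, Nat.cast_sub hn]
    simp

lemma numMinimal_div_eq_swapProb {n i : ℕ} (hi : 1 ≤ i) (hin : i < n) :
    ((n - 2).choose (i - 1) * (numMinimal i * numMinimal (n - i)) : ℝ) / numMinimal n =
      swapProb n i := by
  rw [numMinimal_eq hi, numMinimal_eq (show 1 ≤ n - i by omega),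
    numMinimal_eq (show 1 ≤ n by omega), swapProb, natCast_pow_sub_two hi]
  have h1 : ((n : ℝ) - i) ^ ((n : ℤ) - i - 2) = ((n - i : ℕ) : ℝ) ^ (n - i - 2) := by
    rw [← natCast_pow_sub_two (show 1 ≤ n - i by omega), Nat.cast_sub hin.le, Nat.cast_sub hin.le]
  rw [h1, Nat.cast_choose ℝ (show i - 1 ≤ n - 2 by omega),
    show n - 2 - (i - 1) = n - i - 1 by omega]
  push_cast
  ring

/-- The two cycles left by a transposition play symmetric roles. -/
lemma swapProb_symm {n i : ℕ} (h : i ≤ n) : swapProb n (n - i) = swapProb n i := by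
  rw [swapProb, swapProb, Nat.cast_sub h, Nat.cast_sub h, Nat.sub_sub_self h,
    show (n : ℤ) - (n - i) - 2 = i - 2 by ring, show (n : ℝ) - (n - i) = i by ring]
  ring

lemma sum_mul_swapProb {n : ℕ} (hn : 2 ≤ n) :
    ∑ i ∈ Icc 1 (n - 1), ((n : ℝ) - i) * swapProb n i = 1 := by
  have h := congrArg (Nat.cast (R := ℝ)) (numMinimal_eq_sum hn)
  have h0 : (numMinimal n : ℝ) ≠ 0 := by
    rw [numMinimal_eq (by omega)]
    have : n ≠ 0 := by omega
    positivity
  rw [eq_comm, ← div_self h0]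
  nth_rw 1 [h]
  push_cast
  rw [sum_div]
  refine sum_congr rfl fun i hi => ?_
  rw [mem_Icc] at hi
  rw [← numMinimal_div_eq_swapProb hi.1 (by omega), Nat.cast_sub (by omega)]
  exact mul_div_assoc _ _ _

/-- By symmetry, the total probability is `n` times the sum of the probabilities over the first half
of the range. -/
lemma sum_swapProb_odd {r : ℕ} (hr : 1 ≤ r) :
    ∑ i ∈ Icc 1 r, ((2 * r + 1 : ℕ) : ℝ) * swapProb (2 * r + 1) i = 1 := by
  rw [← sum_mul_swapProb (show 2 ≤ 2 * r + 1 by omega), Nat.add_sub_cancel]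
  have hsplit : Icc 1 (2 * r) = Icc 1 r ∪ Icc (r + 1) (2 * r) := by
    ext i
    simp only [mem_Icc, mem_union]
    omega
  have hdisj : Disjoint (Icc 1 r) (Icc (r + 1) (2 * r)) := by
    rw [disjoint_left]
    intro i
    simp only [mem_Icc]
    omega
  have hrefl : ∑ i ∈ Icc (r + 1) (2 * r), (((2 * r + 1 : ℕ) : ℝ) - i) * swapProb (2 * r + 1) i =
      ∑ i ∈ Icc 1 r, (i : ℝ) * swapProb (2 * r + 1) i := by
    refine sum_bij' (fun i _ => 2 * r + 1 - i) (fun i _ => 2 * r + 1 - i) ?_ ?_ ?_ ?_ ?_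
    · intro i
      simp only [mem_Icc]
      omega
    · intro i
      simp only [mem_Icc]
      omega
    · intro i
      simp only [mem_Icc]
      omega
    · intro i
      simp only [mem_Icc]
      omega
    · intro i hi
      rw [mem_Icc] at hi
      rw [swapProb_symm (by omega), Nat.cast_sub (by omega)]
  rw [hsplit, sum_union hdisj, hrefl, ← sum_add_distrib]
  exact sum_congr rfl fun i _ => by ring

lemma tendsto_add_div_add (a b : ℝ) :
    Tendsto (fun N : ℕ => ((N : ℝ) + a) / (N + b)) atTop (𝓝 1) := by
  have h := tendsto_const_div_atTop_nhds_zero_nat (1 : ℝ)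
  have h1 : Tendsto (fun N : ℕ => (1 + a * (1 / (N : ℝ))) / (1 + b * (1 / (N : ℝ)))) atTop
      (𝓝 ((1 + a * 0) / (1 + b * 0))) :=
    ((h.const_mul a).const_add 1).div ((h.const_mul b).const_add 1) (by simp)
  simp only [mul_zero, add_zero, div_one] at h1
  refine h1.congr' ?_
  filter_upwards [eventually_gt_atTop 0] with N hN
  have : (N : ℝ) ≠ 0 := by positivity
  rw [← mul_div_mul_left _ _ this]
  congr 1 <;> field_simp

lemma tendsto_factorial_ratio (j : ℕ) :
    Tendsto (fun N : ℕ => ((N + j).factorial : ℝ) / (N.factorial * ((N : ℝ) + 1) ^ j)) atTop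
      (𝓝 1) := by
  induction j with
  | zero =>
    refine tendsto_const_nhds.congr fun N => ?_
    have : (N.factorial : ℝ) ≠ 0 := by positivity
    simp [this]
  | succ j ih =>
    have := ih.mul (tendsto_add_div_add (j + 1) 1)
    rw [one_mul] at this
    refine this.congr fun N => ?_
    rw [← Nat.add_assoc, Nat.factorial_succ]
    push_cast
    field_simp
    ring

/-- The local limit of the gap between the two entries of the first factor. -/
lemma tendsto_mul_swapProb (i : ℕ) (hi : 1 ≤ i) :
    Tendsto (fun n : ℕ => (n : ℝ) * swapProb n i) atTop (𝓝 (borelMass i)) := by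
  obtain ⟨j, rfl⟩ : ∃ j, i = j + 1 := ⟨i - 1, by omega⟩
  rw [← tendsto_add_atTop_iff_nat (j + 2)]
  have hexp : Tendsto (fun N : ℕ => (((N : ℝ) + 1) / (N + (j + 2))) ^ (N + 1)) atTop
      (𝓝 (Real.exp (-((j + 1 : ℕ) : ℝ)))) := by
    have h := ((Real.tendsto_one_add_div_pow_exp ((j : ℝ) + 1)).comp (tendsto_add_atTop_nat 1)).inv₀
      (Real.exp_ne_zero _)
    rw [← Real.exp_neg] at h
    push_cast
    refine h.congr fun N => ?_
    simp only [Function.comp_apply]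
    rw [← inv_pow]
    push_cast
    congr 1
    have h1 : (N : ℝ) + 1 ≠ 0 := by positivity
    have h2 : (N : ℝ) + (j + 2) ≠ 0 := by positivity
    rw [inv_eq_iff_eq_inv, inv_div]
    field_simp
    ring
  have hz : Tendsto (fun N : ℕ => (((N : ℝ) + 1) / (N + (j + 2))) ^ ((j : ℤ) - 2)) atTop (𝓝 1) := by
    simpa using (tendsto_add_div_add 1 ((j : ℝ) + 2)).zpow₀ ((j : ℤ) - 2) (Or.inl one_ne_zero)
  have hlim := (((tendsto_factorial_ratio j).mul hexp).mul hz).const_mul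
    (((j + 1 : ℕ) : ℝ) ^ (((j + 1 : ℕ) : ℤ) - 2) / ((j + 1 - 1).factorial : ℝ))
  rw [one_mul, mul_one] at hlim
  refine hlim.congr fun N => ?_
  rw [swapProb]
  have e1 : N + (j + 2) - 2 = N + j := by omega
  have e2 : N + (j + 2) - (j + 1) - 1 = N := by omega
  have e3 : ((N + (j + 2) : ℕ) : ℝ) - ((j + 1 : ℕ) : ℝ) = N + 1 := by push_cast; ring
  have e4 : ((N + (j + 2) : ℕ) : ℤ) - ((j + 1 : ℕ) : ℤ) - 2 = N - 1 := by push_cast; ring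
  have e5 : ((N + (j + 2) : ℕ) : ℝ) = N + (j + 2) := by push_cast; ring
  rw [e1, e2, e3, e4, e5]
  have ha : (N : ℝ) + 1 ≠ 0 := by positivity
  have hb : (N : ℝ) + (j + 2) ≠ 0 := by positivity
  generalize ((j + 1 : ℕ) : ℝ) ^ (((j + 1 : ℕ) : ℤ) - 2) / ((j + 1 - 1).factorial : ℝ) = c
  rw [zpow_sub₀ (div_ne_zero ha hb), zpow_sub₀ ha, zpow_natCast, zpow_natCast, zpow_one,
    show ((2 : ℤ)) = ((2 : ℕ) : ℤ) by rfl, zpow_natCast]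
  generalize (N : ℝ) + 1 = a at *
  generalize (N : ℝ) + (j + 2) = b at *
  have hN : (N.factorial : ℝ) ≠ 0 := by positivity
  rw [div_pow, div_pow]
  field_simp
  ring

/-- The sequence increases because `(1 - 1 / (m + 1)) ^ (m + 1) ≤ e⁻¹`; it compares the factor of
`swapProb n i` that depends on `n - i` with its value at `n`. -/
lemma monotone_pow_mul_exp_div_factorial :
    Monotone fun m : ℕ => (m : ℝ) ^ (m + 1) * Real.exp (-m) / m.factorial := by
  refine monotone_nat_of_le_succ fun m => ?_
  have h1 := Real.one_sub_div_pow_le_exp_neg (n := m + 1) (t := 1) (by simp)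
  have h2 : (1 - 1 / ((m + 1 : ℕ) : ℝ)) ^ (m + 1) = (m : ℝ) ^ (m + 1) / (m + 1) ^ (m + 1) := by
    rw [← div_pow]
    congr 1
    push_cast
    field_simp
    ring
  rw [h2, div_le_iff₀ (by positivity)] at h1
  have h3 : ((m + 1 : ℕ) : ℝ) ^ (m + 1 + 1) * Real.exp (-((m + 1 : ℕ) : ℝ)) /
      (m + 1).factorial = Real.exp (-1) * ((m : ℝ) + 1) ^ (m + 1) * Real.exp (-m) /
        m.factorial := by
    rw [Nat.factorial_succ, show -((m + 1 : ℕ) : ℝ) = -1 + -m by push_cast; ring, Real.exp_add]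
    push_cast
    field_simp
    ring
  rw [h3]
  gcongr

/-- The domination used to let `n` tend to infinity in `sum_swapProb_odd`. -/
lemma mul_swapProb_le {n i : ℕ} (hn : 2 ≤ n) (hi : 2 * i ≤ n) :
    (n : ℝ) * swapProb n i ≤ 8 * borelMass i := by
  obtain ⟨m, rfl⟩ : ∃ m, n = m + i := ⟨n - i, by omega⟩
  have hm : 1 ≤ m := by omega
  have hmono := monotone_pow_mul_exp_div_factorial (show m ≤ m + i by omega)
  simp only at hmono
  rw [swapProb, borelMass]
  have hc : 0 ≤ (i : ℝ) ^ ((i : ℤ) - 2) / ((i - 1).factorial : ℝ) := by positivity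
  generalize (i : ℝ) ^ ((i : ℤ) - 2) / ((i - 1).factorial : ℝ) = c at *
  have e1 : ((m + i : ℕ) : ℝ) - i = m := by push_cast; ring
  have e2 : ((m + i : ℕ) : ℤ) - i - 2 = m - 2 := by push_cast; ring
  rw [e1, e2, Nat.add_sub_cancel]
  have hm0 : (m : ℝ) ≠ 0 := by positivity
  have e3 : (m : ℝ) ^ ((m : ℤ) - 2) / (m - 1).factorial =
      (m : ℝ) ^ (m + 1) * Real.exp (-m) / m.factorial * (Real.exp m / m ^ 2) := by
    obtain ⟨k, rfl⟩ : ∃ k, m = k + 1 := ⟨m - 1, by omega⟩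
    rw [Real.exp_neg, zpow_sub₀ hm0, zpow_natCast, Nat.add_sub_cancel, Nat.factorial_succ]
    have : ((k + 1 : ℕ) : ℝ) ^ (2 : ℤ) = ((k + 1 : ℕ) : ℝ) ^ 2 := by norm_cast
    rw [this]
    push_cast at *
    field_simp
    ring
  obtain ⟨n, hN⟩ : ∃ n, m + i = n + 2 := ⟨m + i - 2, by omega⟩
  have hi' : (i : ℝ) = n + 2 - m := by
    have := congrArg (Nat.cast (R := ℝ)) hN
    push_cast at this
    linarith
  rw [e3]
  rw [hN] at hmono ⊢
  rw [Nat.add_sub_cancel, hi']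
  have key : ((n + 2 : ℕ) : ℝ) * ((n.factorial : ℝ) / ((n + 2 : ℕ) : ℝ) ^ n * c *
      (((n + 2 : ℕ) : ℝ) ^ (n + 2 + 1) * Real.exp (-((n + 2 : ℕ) : ℝ)) / (n + 2).factorial *
        (Real.exp m / m ^ 2))) =
      (((n : ℝ) + 2) ^ 3 / ((n + 1) * m ^ 2)) * (c * Real.exp (-(n + 2 - m))) := by
    rw [show -((n : ℝ) + 2 - m) = -(n + 2) + m by ring, Real.exp_add, Nat.factorial_succ,
      Nat.factorial_succ]
    push_cast
    field_simp
    ring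
  calc _ ≤ ((n + 2 : ℕ) : ℝ) * ((n.factorial : ℝ) / ((n + 2 : ℕ) : ℝ) ^ n * c *
      (((n + 2 : ℕ) : ℝ) ^ (n + 2 + 1) * Real.exp (-((n + 2 : ℕ) : ℝ)) / (n + 2).factorial *
        (Real.exp m / m ^ 2))) := by gcongr
    _ = _ := key
    _ ≤ _ := by
      refine mul_le_mul_of_nonneg_right ?_ (by positivity)
      have h2 : (n : ℝ) + 2 ≤ 2 * m := by exact_mod_cast (by omega : n + 2 ≤ 2 * m)
      rw [div_le_iff₀ (by positivity)]
      have hn0 : (0 : ℝ) ≤ n := by positivity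
      have h3 : ((n : ℝ) + 2) ^ 2 ≤ (2 * m) ^ 2 := by gcongr
      nlinarith [mul_nonneg hn0 (sub_nonneg.2 h3)]

/-- By Stirling's bound, the Borel mass at `i` is at most `i ^ (-3 / 2)`. -/
lemma summable_borelMass : Summable borelMass := by
  refine Summable.of_nonneg_of_le borelMass_nonneg (fun i => ?_)
    (Real.summable_one_div_nat_rpow.2 (show (1 : ℝ) < 3 / 2 by norm_num))
  rcases Nat.eq_zero_or_pos i with rfl | hi
  · simp
  have hs := Stirling.le_factorial_stirling i
  have hi0 : (0 : ℝ) < i := by positivity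
  have hsq : √(i : ℝ) ≤ √(2 * Real.pi * i) := by
    apply Real.sqrt_le_sqrt
    nlinarith [Real.pi_gt_three]
  have e1 : borelMass i = (i : ℝ) ^ i * Real.exp (-i) / (i.factorial * i) := by
    obtain ⟨k, rfl⟩ : ∃ k, i = k + 1 := ⟨i - 1, by omega⟩
    rw [borelMass, zpow_sub₀ hi0.ne', zpow_natCast, Nat.add_sub_cancel, Nat.factorial_succ]
    have : ((k + 1 : ℕ) : ℝ) ^ (2 : ℤ) = ((k + 1 : ℕ) : ℝ) ^ 2 := by norm_cast
    rw [this]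
    push_cast at *
    field_simp
  have e2 : ((i : ℝ) / Real.exp 1) ^ i = (i : ℝ) ^ i * Real.exp (-i) := by
    rw [div_pow, ← Real.exp_nat_mul, mul_one, Real.exp_neg]
    rfl
  have e3 : (i : ℝ) ^ (3 / 2 : ℝ) = i * √i := by
    rw [show (3 / 2 : ℝ) = 1 + 1 / 2 by norm_num, Real.rpow_add hi0, Real.rpow_one,
      Real.sqrt_eq_rpow]
  rw [e1, e3, div_le_div_iff₀ (by positivity) (by positivity), one_mul]
  rw [e2] at hs
  calc (i : ℝ) ^ i * Real.exp (-i) * (i * √i) = √i * (i ^ i * Real.exp (-i)) * i := by ring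
    _ ≤ √(2 * Real.pi * i) * (i ^ i * Real.exp (-i)) * i := by gcongr
    _ ≤ _ := by gcongr

/-- The Borel distribution of parameter `1` has total mass `1`: let `n` tend to infinity along the
odd integers in `sum_swapProb_odd`. -/
lemma hasSum_borelMass : HasSum borelMass 1 := by
  have hdom : Tendsto (fun r : ℕ => ∑' i, if i ∈ Icc 1 r then
      ((2 * r + 1 : ℕ) : ℝ) * swapProb (2 * r + 1) i else 0) atTop (𝓝 (∑' i, borelMass i)) := by
    refine tendsto_tsum_of_dominated_convergence (bound := fun i => 8 * borelMass i)
      (summable_borelMass.mul_left 8) (fun i => ?_) ?_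
    · rcases Nat.eq_zero_or_pos i with rfl | hi
      · simp
      · have ht : Tendsto (fun r : ℕ => 2 * r + 1) atTop atTop :=
          tendsto_atTop_mono (fun r => show r ≤ 2 * r + 1 by omega) tendsto_id
        refine ((tendsto_mul_swapProb i hi).comp ht).congr' ?_
        filter_upwards [eventually_ge_atTop i] with r hr
        rw [if_pos (mem_Icc.2 ⟨hi, hr⟩)]
        rfl
    · filter_upwards with r i
      split_ifs with h
      · rw [mem_Icc] at h
        rw [Real.norm_of_nonneg (mul_nonneg (by positivity) (swapProb_nonneg (by omega)))]
        exact mul_swapProb_le (by omega) (by omega)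
      · simpa using borelMass_nonneg i
  have hone : Tendsto (fun r : ℕ => ∑' i, if i ∈ Icc 1 r then
      ((2 * r + 1 : ℕ) : ℝ) * swapProb (2 * r + 1) i else 0) atTop (𝓝 1) := by
    refine tendsto_const_nhds.congr' ?_
    filter_upwards [eventually_ge_atTop 1] with r hr
    rw [tsum_eq_sum (s := Icc 1 r) (fun i hi => if_neg hi), ← sum_swapProb_odd hr]
    exact sum_congr rfl fun i hi => (if_pos hi).symm
  rw [← tendsto_nhds_unique hdom hone]
  exact summable_borelMass.hasSum

end MinFact

/-! ### Uniform minimal factorizations -/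

namespace MinFact

open Finset

instance permDiscreteMeasurableSpace (n : ℕ) : DiscreteMeasurableSpace (Equiv.Perm (Fin n)) :=
  ⟨fun _ => trivial⟩

lemma minimalFactorizations_eq_coe (n : ℕ) :
    minimalFactorizations n = ↑(factorizations (swaps (Fin n)) (n - 1) (finRotate n)) := by
  ext τ
  simp [minimalFactorizations, mem_factorizations]

lemma map_uniformOn_of_injective {α : Type*} [MeasurableSpace α] [DiscreteMeasurableSpace α]
    {s : Set α} {φ : α → α} (hφ : Function.Injective φ) (hs : φ '' s = s) :
    (uniformOn s).map φ = uniformOn s := by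
  ext A hA
  rw [Measure.map_apply Measurable.of_discrete hA, uniformOn, cond_apply .of_discrete,
    cond_apply .of_discrete, ← Measure.count_injective_image hφ (s ∩ φ ⁻¹' A),
    Set.image_inter_preimage, hs]

/-- Rotation of a tuple `(τ_1, …, τ_k)` to `(τ_2, …, τ_k, g * τ_1 * g⁻¹)`. If `τ` is a factorization
of `g` in the sense of `factorizations`, then so is the rotated tuple. -/
def rotateTuple {G : Type*} [Group G] {ℓ : ℕ} (g : G) (τ : Fin (ℓ + 1) → G) : Fin (ℓ + 1) → G :=
  Fin.snoc (Fin.tail τ) (g * τ 0 * g⁻¹)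

lemma rotateTuple_injective {G : Type*} [Group G] {ℓ : ℕ} (g : G) :
    Function.Injective (rotateTuple (ℓ := ℓ) g) := by
  intro τ τ' h
  obtain ⟨h1, h2⟩ := Fin.snoc_injective2 h
  rw [← Fin.cons_self_tail τ, ← Fin.cons_self_tail τ', h1,
    show τ 0 = τ' 0 by simpa using h2]

lemma rotateTuple_mem_factorizations {α : Type*} [Fintype α] [DecidableEq α] {ℓ : ℕ}
    {σ : Equiv.Perm α} {τ : Fin (ℓ + 1) → Equiv.Perm α}
    (hτ : τ ∈ factorizations (swaps α) (ℓ + 1) σ) :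
    rotateTuple σ τ ∈ factorizations (swaps α) (ℓ + 1) σ := by
  rw [mem_factorizations] at hτ ⊢
  refine ⟨fun j => ?_, ?_⟩
  · refine Fin.lastCases ?_ (fun j => ?_) j
    · obtain ⟨x, y, hxy, h⟩ := mem_swaps.1 (hτ.1 0)
      rw [mem_swaps]
      refine ⟨σ x, σ y, by simpa using hxy, ?_⟩
      simp only [rotateTuple, Fin.snoc_last]
      rw [h, Equiv.swap_apply_apply]
    · simpa [rotateTuple, Fin.tail] using hτ.1 j.succ
  · have h : (List.ofFn (Fin.tail τ)).reverse.prod * τ 0 = σ := by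
      rw [← hτ.2]
      simp [List.ofFn_succ, Fin.tail_def]
    rw [List.ofFn_succ']
    simp only [rotateTuple, Fin.snoc_castSucc, Fin.snoc_last, List.concat_eq_append,
      List.reverse_append, List.prod_append]
    have h' : (List.ofFn (Fin.tail τ)).reverse.prod = σ * (τ 0)⁻¹ := by
      rw [← h, mul_inv_cancel_right]
    change _ * (List.ofFn (Fin.tail τ)).reverse.prod = σ
    rw [h']
    simp

/-- An injective self-map of a finite set is onto. -/
lemma image_rotateTuple_minimalFactorizations (m : ℕ) :
    rotateTuple (finRotate (m + 2)) '' (minimalFactorizations (m + 2)) =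
      minimalFactorizations (m + 2) := by
  have hsub : (factorizations (swaps (Fin (m + 2))) (m + 1) (finRotate (m + 2))).image
      (rotateTuple (finRotate (m + 2))) ⊆
        factorizations (swaps (Fin (m + 2))) (m + 1) (finRotate (m + 2)) :=
    image_subset_iff.2 fun τ hτ => rotateTuple_mem_factorizations hτ
  have := eq_of_subset_of_card_le hsub
    (card_image_of_injective _ (rotateTuple_injective _)).ge
  rw [minimalFactorizations_eq_coe]
  exact_mod_cast congrArg (fun s : Finset (Fin (m + 1) → Equiv.Perm (Fin (m + 2))) =>
    (s : Set (Fin (m + 1) → Equiv.Perm (Fin (m + 2))))) this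

/-- Dropping the last factor of `rotateTuple g τ` is the same as dropping the first factor of `τ`,
and `rotateTuple` preserves the uniform law. -/
lemma identDistrib_castSucc_succ {Ω : Type*} [MeasurableSpace Ω] {P : Measure Ω} {m : ℕ}
    {X : Ω → Fin (m + 1) → Equiv.Perm (Fin (m + 2))}
    (hX : HasLaw X (uniformOn (minimalFactorizations (m + 2))) P) :
    IdentDistrib (fun ω (j : Fin m) => X ω j.castSucc) (fun ω (j : Fin m) => X ω j.succ) P P := by
  have hinit : Measurable fun (τ : Fin (m + 1) → Equiv.Perm (Fin (m + 2))) (j : Fin m) =>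
    τ j.castSucc := Measurable.of_discrete
  have htail : Measurable fun (τ : Fin (m + 1) → Equiv.Perm (Fin (m + 2))) (j : Fin m) =>
    τ j.succ := Measurable.of_discrete
  refine ⟨hinit.comp_aemeasurable hX.aemeasurable, htail.comp_aemeasurable hX.aemeasurable, ?_⟩
  have h1 := AEMeasurable.map_map_of_aemeasurable hinit.aemeasurable hX.aemeasurable
  have h2 := AEMeasurable.map_map_of_aemeasurable htail.aemeasurable hX.aemeasurable
  refine h1.symm.trans (Eq.trans ?_ h2)
  rw [hX.map_eq]
  have h3 : (uniformOn (minimalFactorizations (m + 2))).map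
      (rotateTuple (finRotate (m + 2))) = uniformOn (minimalFactorizations (m + 2)) :=
    map_uniformOn_of_injective (rotateTuple_injective _)
      (image_rotateTuple_minimalFactorizations m)
  conv_lhs => rw [← h3]
  rw [Measure.map_map hinit Measurable.of_discrete]
  congr 1
  ext τ j
  simp [rotateTuple, Fin.tail]

lemma uniformOn_real_finset {α : Type*} [DecidableEq α] [MeasurableSpace α]
    [MeasurableSingletonClass α] (s t : Finset α) :
    (uniformOn (s : Set α)).real t = (#(s ∩ t) : ℝ) / #s := by
  rw [measureReal_def, uniformOn_apply_finset]
  simp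

lemma measureReal_first_eq_swap {Ω : Type*} [MeasurableSpace Ω] {P : Measure Ω} {m : ℕ}
    {X : Ω → Fin (m + 1) → Equiv.Perm (Fin (m + 2))}
    (hX : HasLaw X (uniformOn (minimalFactorizations (m + 2))) P) {i : ℕ} (hi : 1 ≤ i)
    {x y : Fin (m + 2)} (hxy : (x : ℕ) + i = y) :
    P.real {ω | X ω 0 = Equiv.swap x y} = swapProb (m + 2) i := by
  have hy := y.2
  rw [hX.measureReal_eq (p := fun τ => τ 0 = Equiv.swap x y) .of_discrete,
    minimalFactorizations_eq_coe]
  have hset : {τ : Fin (m + 1) → Equiv.Perm (Fin (m + 2)) | τ 0 = Equiv.swap x y} =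
      (({τ | τ 0 = Equiv.swap x y} : Finset (Fin (m + 1) → Equiv.Perm (Fin (m + 2)))) : Set _) := by
    simp
  rw [hset]
  refine (uniformOn_real_finset _ _).trans ?_
  have hcard := card_filter_factorizations_succ (swaps (Fin (m + 2))) m (finRotate (m + 2))
    (s := Equiv.swap x y) (mem_swaps.2 ⟨x, y, fun h => by rw [h] at hxy; omega, rfl⟩)
  rw [Equiv.swap_inv] at hcard
  have hcount := card_factorizations_finRotate_mul_swap hi hxy
  rw [Nat.add_sub_cancel] at hcount
  rw [← numMinimal_div_eq_swapProb hi (by omega), ← filter_mem_eq_inter]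
  simp only [mem_filter, mem_univ, true_and]
  congr 1
  rw [← Nat.cast_mul, ← Nat.cast_mul]
  exact congrArg Nat.cast (hcard.trans hcount)

end MinFact

/-! ### Convergence in distribution -/

namespace MinFact

open Finset

/-- `μ` is the joint law of the entries `a < b` of a transposition of `{1, …, n}` that takes each
value `(k, k + i)` with probability `swapProb n i`. -/
structure IsFirstFactorLaw (n : ℕ) (μ : Measure (ℕ × ℕ)) : Prop where
  ae_mem : ∀ᵐ p ∂μ, 1 ≤ p.1 ∧ p.1 < p.2 ∧ p.2 ≤ n
  measureReal_singleton : ∀ k i : ℕ, 1 ≤ k → 1 ≤ i → k + i ≤ n →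
    μ.real {(k, k + i)} = swapProb n i

/-- The mass of the pairs `(k, k + i)` with `k ∈ s` and `i ∈ t`. -/
lemma sum_measureReal_pair {n : ℕ} {μ : Measure (ℕ × ℕ)} [IsProbabilityMeasure μ]
    (h : IsFirstFactorLaw n μ) (s t : Finset ℕ) (hs : ∀ k ∈ s, 1 ≤ k) (ht : ∀ i ∈ t, 1 ≤ i)
    (hst : ∀ k ∈ s, ∀ i ∈ t, k + i ≤ n) :
    μ.real ((s ×ˢ t).image fun q => (q.1, q.1 + q.2)) = #s * ∑ i ∈ t, swapProb n i := by
  rw [← sum_measureReal_singleton, sum_image, sum_product]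
  · rw [← nsmul_eq_mul, ← sum_const]
    exact sum_congr rfl fun k hk => sum_congr rfl fun i hi =>
      h.measureReal_singleton k i (hs k hk) (ht i hi) (hst k hk i hi)
  · rintro ⟨k, i⟩ _ ⟨k', i'⟩ _ hkk
    simp only [Prod.mk.injEq] at hkk ⊢
    omega

lemma measureReal_gap_eq {n : ℕ} {μ : Measure (ℕ × ℕ)} [IsProbabilityMeasure μ]
    (h : IsFirstFactorLaw n μ) {i : ℕ} (hi : 1 ≤ i) (hin : i ≤ n) :
    μ.real {p | (p.2 : ℤ) - p.1 = i} = (n - i : ℕ) * swapProb n i := by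
  have := sum_measureReal_pair h (Icc 1 (n - i)) {i}
    (fun k hk => (mem_Icc.1 hk).1) (by simpa using hi) (by
    simp only [mem_Icc, mem_singleton]
    omega)
  rw [Nat.card_Icc, Nat.add_sub_cancel, sum_singleton] at this
  rw [← this]
  refine measureReal_congr ?_
  filter_upwards [h.ae_mem] with p hp
  refine propext ⟨fun (hpi : (p.2 : ℤ) - p.1 = i) => ?_, fun hp' => ?_⟩
  · refine mem_coe.2 (mem_image.2 ⟨(p.1, i), ?_, ?_⟩)
    · exact mem_product.2 ⟨mem_Icc.2 ⟨hp.1, by simp only; omega⟩, mem_singleton_self _⟩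
    · exact Prod.ext rfl (by simp only; omega)
  · obtain ⟨q, hq, rfl⟩ := mem_image.1 (mem_coe.1 hp')
    simp only [mem_product, mem_singleton] at hq
    change (((q.1 + q.2 : ℕ) : ℤ) - q.1 = i)
    rw [← hq.2]
    push_cast
    ring

lemma measureReal_gap_eq_zero {n : ℕ} {μ : Measure (ℕ × ℕ)} [IsProbabilityMeasure μ]
    (h : IsFirstFactorLaw n μ) {j : ℤ} (hj : j ≤ 0) :
    μ.real {p | (p.2 : ℤ) - p.1 = j} = 0 := by
  rw [measureReal_def, ENNReal.toReal_eq_zero_iff]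
  left
  refine measure_mono_null ?_ (ae_iff.1 h.ae_mem)
  intro p (hp : (p.2 : ℤ) - p.1 = j)
  simp only [Set.mem_ofPred_eq]
  omega

lemma tendsto_measureReal_gap {μ : ℕ → Measure (ℕ × ℕ)} [∀ n, IsProbabilityMeasure (μ n)]
    (h : ∀ n, 3 ≤ n → IsFirstFactorLaw n (μ n)) {i : ℕ} (hi : 1 ≤ i) :
    Tendsto (fun n => (μ n).real {p | (p.2 : ℤ) - p.1 = i}) atTop (𝓝 (borelMass i)) := by
  have h1 := (tendsto_add_div_add (-(i : ℝ)) 0).mul (tendsto_mul_swapProb i hi)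
  rw [one_mul] at h1
  refine h1.congr' ?_
  filter_upwards [eventually_ge_atTop 3, eventually_ge_atTop i] with n hn hin
  rw [measureReal_gap_eq (h n hn) hi hin, Nat.cast_sub hin]
  have : (n : ℝ) ≠ 0 := by positivity
  field_simp
  ring

lemma le_measureReal_fst_mem {n K : ℕ} {μ : Measure (ℕ × ℕ)} [IsProbabilityMeasure μ]
    (h : IsFirstFactorLaw n μ) (s : Finset ℕ) (hs : ∀ k ∈ s, 1 ≤ k ∧ k + K ≤ n) {B : Set (ℕ × ℕ)}
    (hB : ∀ p : ℕ × ℕ, p.1 ∈ s → p ∈ B) :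
    #s * ∑ i ∈ Icc 1 K, swapProb n i ≤ μ.real B := by
  rw [← sum_measureReal_pair h s (Icc 1 K) (fun k hk => (hs k hk).1)
    (fun i hi => (mem_Icc.1 hi).1) (fun k hk i hi => by
      have := (hs k hk).2
      have := (mem_Icc.1 hi).2
      omega)]
  refine measureReal_mono ?_
  intro p hp
  obtain ⟨q, hq, rfl⟩ := mem_image.1 (mem_coe.1 hp)
  exact hB _ (mem_product.1 hq).1

lemma tendsto_sum_Icc_borelMass : Tendsto (fun K => ∑ i ∈ Icc 1 K, borelMass i) atTop (𝓝 1) := by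
  refine ((tendsto_add_atTop_iff_nat 1).2 hasSum_borelMass.tendsto_sum_nat).congr fun K => ?_
  rw [sum_range_succ', borelMass_zero, add_zero, range_eq_Ico, sum_Ico_add' borelMass 0 K 1]
  refine sum_congr ?_ fun _ _ => rfl
  ext i
  simp only [mem_Ico, mem_Icc]
  omega

/-- If the first `K` gaps already force `u n` to be asymptotically at least `x` times their total
mass, for every `K`, then no mass is lost in the limit. -/
lemma eventually_lt_of_forall_sum_le {u : ℕ → ℝ} {x : ℝ}
    (hu : ∀ K : ℕ, ∀ᶠ n : ℕ in atTop,
      (n * x - (K + 1)) * ∑ i ∈ Icc 1 K, swapProb n i ≤ u n) {c : ℝ} (hc : c < x) :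
    ∀ᶠ n in atTop, c < u n := by
  have h1 := tendsto_sum_Icc_borelMass.const_mul x
  rw [mul_one] at h1
  obtain ⟨K, hK⟩ := (h1.eventually_const_lt hc).exists
  have h2 : Tendsto (fun n : ℕ => ∑ i ∈ Icc 1 K, (n : ℝ) * swapProb n i) atTop
      (𝓝 (∑ i ∈ Icc 1 K, borelMass i)) :=
    tendsto_finsetSum _ fun i hi => tendsto_mul_swapProb i (mem_Icc.1 hi).1
  have h3 : Tendsto (fun n : ℕ => x - ((K : ℝ) + 1) / n) atTop (𝓝 x) := by
    simpa using (tendsto_const_div_atTop_nhds_zero_nat ((K : ℝ) + 1)).const_sub x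
  filter_upwards [(h3.mul h2).eventually_const_lt hK, hu K, eventually_gt_atTop 0] with n hn hun hn0
  refine hn.trans_le (le_of_eq_of_le ?_ hun)
  rw [← mul_sum]
  have : (n : ℝ) ≠ 0 := by positivity
  field_simp

/-- Lower bounds for the masses on both sides of `x` give the convergence of the distribution
function. -/
lemma tendsto_measureReal_fst_div_le {μ : ℕ → Measure (ℕ × ℕ)} [∀ n, IsProbabilityMeasure (μ n)]
    (h : ∀ n, 3 ≤ n → IsFirstFactorLaw n (μ n)) {x : ℝ} (hx0 : 0 ≤ x) (hx1 : x ≤ 1) :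
    Tendsto (fun n => (μ n).real {p | (p.1 : ℝ) / n ≤ x}) atTop (𝓝 x) := by
  have hmem : ∀ n : ℕ, 0 < n → ∀ k : ℕ, (k : ℝ) / n ≤ x ↔ k ≤ ⌊n * x⌋₊ := by
    intro n hn k
    rw [Nat.le_floor_iff (by positivity), div_le_iff₀ (by positivity), mul_comm]
  refine tendsto_order.2 ⟨fun c hc => ?_, fun c hc => ?_⟩
  · refine eventually_lt_of_forall_sum_le (fun K => ?_) hc
    filter_upwards [eventually_ge_atTop 3, eventually_ge_atTop K] with n hn hK
    refine le_trans ?_ (le_measureReal_fst_mem (h n hn) (Icc 1 (min ⌊n * x⌋₊ (n - K)))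
      (K := K) (fun k hk => ?_) (fun p hp => ?_))
    · refine mul_le_mul_of_nonneg_right ?_ (sum_nonneg fun i hi =>
        swapProb_nonneg ((mem_Icc.1 hi).2.trans hK))
      rw [Nat.card_Icc, Nat.add_sub_cancel, Nat.cast_min, le_min_iff, Nat.cast_sub hK]
      have h1 := Nat.lt_floor_add_one ((n : ℝ) * x)
      have h2 : (n : ℝ) * x ≤ n := mul_le_of_le_one_right (by positivity) hx1
      have h3 : (0 : ℝ) ≤ K := by positivity
      constructor <;> linarith
    · rw [mem_Icc, le_min_iff] at hk
      omega
    · rw [mem_Icc, le_min_iff] at hp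
      exact (hmem n (by omega) p.1).2 hp.2.1
  · have hc' : 1 - c < 1 - x := by linarith
    have hev : ∀ᶠ n in atTop, 1 - c < 1 - (μ n).real {p | (p.1 : ℝ) / n ≤ x} := by
      refine eventually_lt_of_forall_sum_le (fun K => ?_) hc'
      filter_upwards [eventually_ge_atTop 3, eventually_ge_atTop K] with n hn hK
      rw [← probReal_compl_eq_one_sub .of_discrete]
      refine le_trans ?_ (le_measureReal_fst_mem (h n hn) (Icc (⌊n * x⌋₊ + 1) (n - K))
        (K := K) (fun k hk => ?_) (fun p hp => ?_))
      · refine mul_le_mul_of_nonneg_right ?_ (sum_nonneg fun i hi =>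
          swapProb_nonneg ((mem_Icc.1 hi).2.trans hK))
        rw [Nat.card_Icc, Nat.add_sub_add_right]
        have h1 := Nat.floor_le (show 0 ≤ (n : ℝ) * x by positivity)
        have h2 : ((n - K : ℕ) : ℝ) ≤ ((n - K - ⌊n * x⌋₊ : ℕ) : ℝ) + ⌊n * x⌋₊ := by
          exact_mod_cast Nat.sub_le_iff_le_add.1 le_rfl
        rw [Nat.cast_sub hK] at h2
        linarith
      · rw [mem_Icc] at hk
        omega
      · rw [mem_Icc] at hp
        intro hp'
        have := (hmem n (by omega) p.1).1 hp'
        omega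
    filter_upwards [hev] with n hn
    linarith

section Distribution

variable {Ω : ℕ → Type*} [∀ n, MeasurableSpace (Ω n)] {P : ∀ n, Measure (Ω n)}
  [∀ n, IsProbabilityMeasure (P n)] {Ω' : Type*} [MeasurableSpace Ω'] {P' : Measure Ω'}
  [IsProbabilityMeasure P']

/-- For integer-valued random variables, convergence of the point masses to those of a random
variable implies convergence in distribution. -/
lemma tendstoInDistribution_of_tendsto_measureReal_singleton {X : ∀ n, Ω n → ℤ} {Z : Ω' → ℤ}
    (hX : ∀ n, AEMeasurable (X n) (P n)) (hZ : AEMeasurable Z P')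
    (h : ∀ j, Tendsto (fun n => (P n).real {ω | X n ω = j}) atTop (𝓝 (P'.real {ω | Z ω = j}))) :
    TendstoInDistribution X atTop Z P P' := by
  refine ⟨hX, hZ, ?_⟩
  refine IsPiSystem.tendsto_probabilityMeasure_of_tendsto_of_mem
    (S := {s | ∃ j : ℤ, s = {j}}) ?_ (fun _ _ => .of_discrete) ?_ ?_
  · rintro _ ⟨j, rfl⟩ _ ⟨k, rfl⟩ ⟨l, hj, hk⟩
    rw [Set.mem_singleton_iff] at hj hk
    exact ⟨l, by simp [← hj, ← hk]⟩
  · exact fun u _ x hx => ⟨{x}, ⟨x, rfl⟩, by simp, by simpa using hx⟩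
  · rintro _ ⟨j, rfl⟩
    rw [← NNReal.tendsto_coe]
    convert h j using 2
    · exact map_measureReal_apply_of_aemeasurable (hX _) .of_discrete
    · exact map_measureReal_apply_of_aemeasurable hZ .of_discrete

/-- Pointwise convergence of the distribution functions implies convergence in distribution. -/
lemma tendstoInDistribution_of_tendsto_measureReal_le {X : ∀ n, Ω n → ℝ} {Z : Ω' → ℝ}
    (hX : ∀ n, AEMeasurable (X n) (P n)) (hZ : AEMeasurable Z P')
    (h : ∀ x, Tendsto (fun n => (P n).real {ω | X n ω ≤ x}) atTop (𝓝 (P'.real {ω | Z ω ≤ x}))) :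
    TendstoInDistribution X atTop Z P P' := by
  have hIoc : ∀ (ν : Measure ℝ) [IsProbabilityMeasure ν] {c d : ℝ}, c < d →
      ν.real (Set.Ioc c d) = ν.real (Set.Iic d) - ν.real (Set.Iic c) := by
    intro ν _ c d hcd
    rw [← Set.Iic_sdiff_Iic, measureReal_sdiff (Set.Iic_subset_Iic.2 hcd.le) measurableSet_Iic]
  have hlim : ∀ x, Tendsto (fun n => ((P n).map (X n)).real (Set.Iic x)) atTop
      (𝓝 ((P'.map Z).real (Set.Iic x))) := by
    intro x
    convert h x using 2
    · exact map_measureReal_apply_of_aemeasurable (hX _) measurableSet_Iic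
    · exact map_measureReal_apply_of_aemeasurable hZ measurableSet_Iic
  refine ⟨hX, hZ, ?_⟩
  have hpi := isPiSystem_Ioc (id : ℝ → ℝ) (id : ℝ → ℝ)
  refine IsPiSystem.tendsto_probabilityMeasure_of_tendsto_of_mem hpi ?_ ?_ ?_
  · rintro _ ⟨c, d, -, rfl⟩
    exact measurableSet_Ioc
  · intro u hu x hx
    obtain ⟨ε, hε, hball⟩ := Metric.isOpen_iff.1 hu x hx
    refine ⟨Set.Ioc (x - ε / 2) (x + ε / 2), ⟨x - ε / 2, x + ε / 2, by simp only [id]; linarith,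
      rfl⟩, Ioc_mem_nhds (by linarith) (by linarith), fun y hy => hball ?_⟩
    rw [Metric.mem_ball, Real.dist_eq, abs_lt]
    constructor <;> linarith [hy.1, hy.2]
  · rintro _ ⟨c, d, hcd, rfl⟩
    rw [← NNReal.tendsto_coe]
    have hPn : ∀ n, IsProbabilityMeasure ((P n).map (X n)) := fun n =>
      Measure.isProbabilityMeasure_map (hX n)
    have hP' : IsProbabilityMeasure (P'.map Z) := Measure.isProbabilityMeasure_map hZ
    convert (hlim d).sub (hlim c) using 2
    · exact @hIoc _ (hPn _) _ _ hcd
    · exact @hIoc _ hP' _ _ hcd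

end Distribution

lemma borelDistribution_one_singleton (i : ℕ) :
    borelDistribution 1 {i} = ENNReal.ofReal (borelMass i) := by
  rw [borelDistribution, Measure.sum_apply _ .of_discrete, tsum_eq_single i]
  · rcases i with _ | k
    · simp
    · rw [if_neg (Nat.succ_ne_zero k)]
      simp only [Measure.smul_apply, Measure.dirac_apply_of_mem (Set.mem_singleton _), smul_eq_mul,
        mul_one]
      congr 1
      have : ((k + 1 : ℕ) : ℝ) ≠ 0 := by positivity
      have h2 : ((k + 1 : ℕ) : ℝ) ^ (2 : ℤ) = ((k + 1 : ℕ) : ℝ) ^ 2 := by norm_cast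
      rw [borelMass, zpow_sub₀ this, zpow_natCast, h2, Nat.add_sub_cancel, Nat.factorial_succ,
        one_mul]
      push_cast at *
      field_simp
      ring
  · intro j hj
    rcases eq_or_ne j 0 with rfl | h0
    · simp
    · simp [h0, hj]

lemma isProbabilityMeasure_borelDistribution_one : IsProbabilityMeasure (borelDistribution 1) := by
  constructor
  have h : borelDistribution 1 Set.univ = ∑' i, borelDistribution 1 {i} := by
    rw [← Set.iUnion_of_singleton ℕ]
    exact measure_iUnion (fun i j hij => by simpa using hij) fun i => .of_discrete
  rw [h]
  simp only [borelDistribution_one_singleton]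
  rw [← ENNReal.ofReal_tsum_of_nonneg borelMass_nonneg hasSum_borelMass.summable,
    hasSum_borelMass.tsum_eq, ENNReal.ofReal_one]

lemma borelDistribution_one_real_singleton (i : ℕ) :
    (borelDistribution 1).real {i} = borelMass i := by
  rw [measureReal_def, borelDistribution_one_singleton, ENNReal.toReal_ofReal (borelMass_nonneg i)]

end MinFact

/-! ### Random minimal factorizations -/

namespace MinFact

lemma isFirstFactorLaw_map {Ω : Type*} [MeasurableSpace Ω] {P : Measure Ω} {m : ℕ}
    {X : Ω → Fin (m + 1) → Equiv.Perm (Fin (m + 2))}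
    (hX : HasLaw X (uniformOn (minimalFactorizations (m + 2))) P) {A B : Ω → ℕ}
    (hA : AEMeasurable A P) (hB : AEMeasurable B P)
    (hAB : ∀ᵐ ω ∂P, ∃ h : 1 ≤ A ω ∧ A ω < B ω ∧ B ω ≤ m + 2,
      X ω 0 = transposition (m + 2) (A ω) (B ω) h) :
    IsFirstFactorLaw (m + 2) (P.map fun ω => (A ω, B ω)) := by
  constructor
  · rw [ae_map_iff (hA.prodMk hB) .of_discrete]
    filter_upwards [hAB] with ω hω using hω.1
  · intro k i hk hi hki
    rw [map_measureReal_apply_of_aemeasurable (hA.prodMk hB) .of_discrete,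
      ← measureReal_first_eq_swap hX hi (x := ⟨k - 1, by omega⟩) (y := ⟨k + i - 1, by omega⟩)
        (by simp only; omega)]
    refine measureReal_congr ?_
    filter_upwards [hAB] with ω ⟨h, hω⟩
    refine propext ⟨fun (h1 : (A ω, B ω) = (k, k + i)) => ?_, fun h1 => ?_⟩
    · rw [Prod.mk.injEq] at h1
      change X ω 0 = _
      rw [hω, transposition]
      simp only [h1.1, h1.2]
    · change X ω 0 = _ at h1
      rw [hω, transposition] at h1
      obtain ⟨h2, h3⟩ := eq_and_eq_of_swap_eq_swap (by rw [Fin.lt_def]; simp only; omega)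
        (by rw [Fin.lt_def]; simp only; omega) h1
      rw [Fin.mk.injEq] at h2 h3
      change (A ω, B ω) = (k, k + i)
      rw [Prod.mk.injEq]
      omega

lemma measureReal_unitInterval_le (x : ℝ) :
    (volume : Measure unitInterval).real {u | (u : ℝ) ≤ x} = max 0 (min x 1) := by
  rcases lt_or_ge x 0 with hx | hx
  · have : {u : unitInterval | (u : ℝ) ≤ x} = ∅ := by
      ext u
      simpa using hx.trans_le u.2.1
    rw [this, measureReal_empty, max_eq_left (min_le_of_left_le hx.le)]
  rcases le_or_gt x 1 with hx1 | hx1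
  · have : {u : unitInterval | (u : ℝ) ≤ x} = Set.Iic ⟨x, hx, hx1⟩ := rfl
    rw [this, measureReal_def, unitInterval.volume_Iic, ENNReal.toReal_ofReal hx,
      min_eq_left hx1, max_eq_right hx]
  · have : {u : unitInterval | (u : ℝ) ≤ x} = Set.univ := by
      ext u
      simpa using u.2.2.trans hx1.le
    rw [this, probReal_univ, min_eq_right hx1.le, max_eq_right zero_le_one]

section Limits

variable {Ω : ℕ → Type*} [∀ n, MeasurableSpace (Ω n)] {P : ∀ n, Measure (Ω n)}
  [∀ n, IsProbabilityMeasure (P n)] {a b : ∀ n, Ω n → ℕ}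

lemma tendsto_measureReal_sub_eq (ha : ∀ n, AEMeasurable (a n) (P n))
    (hb : ∀ n, AEMeasurable (b n) (P n))
    (hlaw : ∀ n, 3 ≤ n → IsFirstFactorLaw n ((P n).map fun ω => (a n ω, b n ω))) {i : ℕ}
    (hi : 1 ≤ i) :
    Tendsto (fun n => (P n).real {ω | (b n ω : ℤ) - a n ω = i}) atTop (𝓝 (borelMass i)) := by
  have hprob : ∀ n, IsProbabilityMeasure ((P n).map fun ω => (a n ω, b n ω)) := fun n =>
    Measure.isProbabilityMeasure_map ((ha n).prodMk (hb n))
  refine (tendsto_measureReal_gap hlaw hi).congr fun n => ?_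
  exact map_measureReal_apply_of_aemeasurable ((ha n).prodMk (hb n)) .of_discrete

lemma tendstoInDistribution_sub [IsProbabilityMeasure (borelDistribution 1)]
    (ha : ∀ n, AEMeasurable (a n) (P n)) (hb : ∀ n, AEMeasurable (b n) (P n))
    (hlaw : ∀ n, 3 ≤ n → IsFirstFactorLaw n ((P n).map fun ω => (a n ω, b n ω))) :
    TendstoInDistribution (fun n ω => (b n ω : ℝ) - a n ω) atTop
      (fun k : ℕ => (k : ℝ)) P (borelDistribution 1) := by
  have hprob : ∀ n, IsProbabilityMeasure ((P n).map fun ω => (a n ω, b n ω)) := fun n =>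
    Measure.isProbabilityMeasure_map ((ha n).prodMk (hb n))
  have hZ : TendstoInDistribution (fun n ω => (b n ω : ℤ) - a n ω) atTop
      (fun k : ℕ => (k : ℤ)) P (borelDistribution 1) := by
    refine tendstoInDistribution_of_tendsto_measureReal_singleton (fun n => ?_) (by fun_prop)
      fun j => ?_
    · exact (Measurable.of_discrete (f := fun p : ℕ × ℕ => (p.2 : ℤ) - p.1)).comp_aemeasurable
        ((ha n).prodMk (hb n))
    · rcases le_or_gt j 0 with hj | hj
      · have h0 : (borelDistribution 1).real {k : ℕ | (k : ℤ) = j} = 0 := by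
          have hsub : {k : ℕ | (k : ℤ) = j} ⊆ {0} := fun k (hk : (k : ℤ) = j) => by
            rw [Set.mem_singleton_iff]
            omega
          refine le_antisymm ((measureReal_mono hsub).trans_eq ?_) measureReal_nonneg
          rw [borelDistribution_one_real_singleton, borelMass_zero]
        rw [h0]
        refine tendsto_const_nhds.congr' ?_
        filter_upwards [eventually_ge_atTop 3] with n hn
        rw [← measureReal_gap_eq_zero (hlaw n hn) hj]
        exact map_measureReal_apply_of_aemeasurable ((ha n).prodMk (hb n)) .of_discrete
      · lift j to ℕ using hj.le
        have hset : {k : ℕ | (k : ℤ) = j} = {j} := by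
          ext k
          simp
        rw [hset, borelDistribution_one_real_singleton]
        exact tendsto_measureReal_sub_eq ha hb hlaw (by omega)
  have h := hZ.continuous_comp (g := fun z : ℤ => (z : ℝ)) continuous_of_discreteTopology
  refine h.congr (fun n => ?_) ?_ <;> exact Eventually.of_forall fun _ => by simp

lemma tendstoInDistribution_div (ha : ∀ n, AEMeasurable (a n) (P n))
    (hb : ∀ n, AEMeasurable (b n) (P n))
    (hlaw : ∀ n, 3 ≤ n → IsFirstFactorLaw n ((P n).map fun ω => (a n ω, b n ω))) :
    TendstoInDistribution (fun n ω => (a n ω : ℝ) / n) atTop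
      (fun u : unitInterval => (u : ℝ)) P (volume : Measure unitInterval) := by
  have hprob : ∀ n, IsProbabilityMeasure ((P n).map fun ω => (a n ω, b n ω)) := fun n =>
    Measure.isProbabilityMeasure_map ((ha n).prodMk (hb n))
  refine tendstoInDistribution_of_tendsto_measureReal_le (fun n => ?_) (by fun_prop) fun x => ?_
  · exact (Measurable.of_discrete (f := fun k : ℕ => (k : ℝ) / n)).comp_aemeasurable (ha n)
  · rw [measureReal_unitInterval_le]
    have hmap : ∀ n, ((P n).map fun ω => (a n ω, b n ω)).real {p | (p.1 : ℝ) / n ≤ x} =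
        (P n).real {ω | (a n ω : ℝ) / n ≤ x} := fun n =>
      map_measureReal_apply_of_aemeasurable ((ha n).prodMk (hb n)) .of_discrete
    rcases lt_or_ge x 0 with hx | hx
    · rw [max_eq_left (min_le_of_left_le hx.le)]
      refine tendsto_const_nhds.congr fun n => ?_
      have : {ω | (a n ω : ℝ) / n ≤ x} = ∅ := by
        ext ω
        have : (0 : ℝ) ≤ (a n ω : ℝ) / n := by positivity
        simpa using hx.trans_le this
      rw [this, measureReal_empty]
    rcases le_or_gt x 1 with hx1 | hx1
    · rw [min_eq_left hx1, max_eq_right hx]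
      exact (tendsto_measureReal_fst_div_le hlaw hx hx1).congr hmap
    · rw [min_eq_right hx1.le, max_eq_right zero_le_one]
      refine tendsto_const_nhds.congr' ?_
      filter_upwards [eventually_ge_atTop 3] with n hn
      rw [← hmap, ← probReal_univ (μ := (P n).map fun ω => (a n ω, b n ω))]
      refine measureReal_congr ?_
      filter_upwards [(hlaw n hn).ae_mem] with p hp
      refine propext ⟨fun _ => ?_, fun _ => trivial⟩
      change (p.1 : ℝ) / n ≤ x
      refine le_trans ?_ hx1.le
      have : (0 : ℝ) < n := by positivity
      rw [div_le_one this]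
      exact_mod_cast (hp.2.1.le.trans hp.2.2)

end Limits

end MinFact

theorem mainTheorem4 {Ω : ℕ → Type*} [∀ n, MeasurableSpace (Ω n)]
    (P : ∀ n, Measure (Ω n)) [∀ n, IsProbabilityMeasure (P n)]
    -- for each `n ≥ 3`, a uniform random minimal factorization of size `n`
    (t : ∀ n, Ω n → Fin (n - 1) → Equiv.Perm (Fin n))
    (ht : ∀ n, 3 ≤ n → HasLaw (t n) (uniformOn (MinFact.minimalFactorizations n)) (P n))
    -- the first factor is written `(a_n, b_n)` with `a_n < b_n`
    (a b : ∀ n, Ω n → ℕ)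
    (ha : ∀ n, AEMeasurable (a n) (P n)) (hb : ∀ n, AEMeasurable (b n) (P n))
    (hab : ∀ n, ∀ hn : 3 ≤ n, ∀ᵐ ω ∂(P n), ∃ h : 1 ≤ a n ω ∧ a n ω < b n ω ∧ b n ω ≤ n,
      t n ω ⟨0, by omega⟩ = MinFact.transposition n (a n ω) (b n ω) h) :
    -- (i)
    (∀ n, 3 ≤ n →
      IdentDistrib
        (fun (ω : Ω n) (j : Fin (n - 2)) => t n ω ⟨j, by omega⟩)
        (fun (ω : Ω n) (j : Fin (n - 2)) => t n ω ⟨j + 1, by omega⟩)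
        (P n) (P n)) ∧
    -- (ii)
    (∀ n, ∀ hn : 3 ≤ n, ∀ k i : ℕ, ∀ hk : 1 ≤ k, ∀ hi : 1 ≤ i, ∀ hki : k + i ≤ n,
      (P n).real {ω | t n ω ⟨0, by omega⟩ =
          MinFact.transposition n k (k + i) ⟨hk, by omega, hki⟩} =
        ((n - 2).factorial : ℝ) / (n : ℝ) ^ (n - 2) *
          ((i : ℝ) ^ ((i : ℤ) - 2) / ((i - 1).factorial : ℝ)) *
          (((n : ℝ) - i) ^ ((n : ℤ) - i - 2) / ((n - i - 1).factorial : ℝ))) ∧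
    (∀ i : ℕ, 1 ≤ i →
      Tendsto (fun n => (P n).real {ω | (b n ω : ℤ) - a n ω = i}) atTop
        (𝓝 ((i : ℝ) ^ ((i : ℤ) - 2) / ((i - 1).factorial : ℝ) * Real.exp (-(i : ℝ))))) ∧
    (∃ _ : IsProbabilityMeasure (MinFact.borelDistribution 1),
      TendstoInDistribution (fun n ω => (b n ω : ℝ) - a n ω) atTop
        (fun k : ℕ => (k : ℝ)) P (MinFact.borelDistribution 1)) ∧
    TendstoInDistribution (fun n ω => (a n ω : ℝ) / n) atTop
      (fun u : unitInterval => (u : ℝ)) P (volume : Measure unitInterval) := by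
  have hlaw : ∀ n, 3 ≤ n → MinFact.IsFirstFactorLaw n ((P n).map fun ω => (a n ω, b n ω)) := by
    intro n hn
    have hn' := hn
    obtain ⟨m, rfl⟩ : ∃ m, n = m + 2 := ⟨n - 2, by omega⟩
    exact MinFact.isFirstFactorLaw_map (ht _ hn') (ha _) (hb _) (hab _ hn')
  have hborel := MinFact.isProbabilityMeasure_borelDistribution_one
  refine ⟨fun n hn => ?_, fun n hn k i hk hi hki => ?_,
    fun i hi => MinFact.tendsto_measureReal_sub_eq ha hb hlaw hi,
    ⟨hborel, MinFact.tendstoInDistribution_sub ha hb hlaw⟩,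
    MinFact.tendstoInDistribution_div ha hb hlaw⟩
  · have hX := ht n hn
    obtain ⟨m, rfl⟩ : ∃ m, n = m + 2 := ⟨n - 2, by omega⟩
    exact MinFact.identDistrib_castSucc_succ hX
  · have hX := ht n hn
    obtain ⟨m, rfl⟩ : ∃ m, n = m + 2 := ⟨n - 2, by omega⟩
    exact MinFact.measureReal_first_eq_swap hX hi
      (x := ⟨k - 1, by omega⟩) (y := ⟨k + i - 1, by omega⟩) (by simp only; omega)
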